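/- Let $(X_1,Y_1),\dots,(X_n,Y_n)$ be i.i.d. pairs of a covariate vector $X_i\in\mathbb R^p$ and a binary response $Y_i\in\{0,1\}$ that follow the logistic regression model with parameter $\beta_0\in\mathbb R^p$: the conditional probability $\pi(x)\in(0,1)$ of $Y_i=1$ given $X_i=x$ satisfies $\log\frac{\pi(x)}{1-\pi(x)}=x^\top\beta_0$. Here $n,p\ge 2$. Let $J_0=\{j\in[p]:(\beta_0)_j\ne 0\}$. For constants $a_1,a_2,a_3>0$ and an integer $q\ge1$, say that the covariates satisfy (A1)–(A3) with respect to $q$ if, for every $u\in\mathbb R^p$ with $\|u\|_2=1$ and at most $q$ non-zero entries, (A1) $\mathbb E[(X_1^\top u)^2]\ge a_1$ and (A2) $\mathbb E[|X_1^\top u|^3]\le a_2$, and if (A3) $|X_{1j}|\le a_3$ almost surely for each $j\in[p]$. Let $\ell_n(\beta)=\sum_{i=1}^n\bigl(Y_iX_i^\top\beta-\log(1+e^{X_i^\top\beta})\bigr)$ be the log-likelihood. For $J\subseteq[p]$ let $\hat\beta_J$ denote a maximizer of $\ell_n$ over the vectors $\beta\in\mathbb R^p$ with support contained in $J$, and for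 $\gamma\ge0$ let $$\mathrm{BIC}_\gamma(J)=-2\,\ell_n(\hat\beta_J)+|J|\bigl(\log n+2\gamma\log p\bigr).$$ **Theorem.** Let $a_0,a_1,a_2,a_3>0$ and $\epsilon,\nu>0$. There exist constants $C_0,C_1,C_2,C_3>0$, depending only on $(a_0,a_1,a_2,a_3)$ and $(\epsilon,\nu)$, such that the following holds for all $\gamma\ge0$, all $n,p\ge2$, all $q\ge 1$ and all logistic regression models as above. Suppose that $\|\beta_0\|_2\le a_0$, that $|J_0|\le q$, that the covariates satisfy (A1)–(A3) with respect to $2q$, that $$p\ge C_0,\qquad n\ge\max\Bigl\{C_1\,q^3\log p,\ C_2\,\frac{q\log(np^{2\gamma})}{\min_{j\in J_0}|(\beta_0)_j|^2}\Bigr\}$$ (the second term being absent if $J_0=\emptyset$), and that $\sqrt n>p^{(1+\epsilon)(1+\nu)-\gamma}$. Then, with probability at least $$\Bigl(1-\exp\Bigl\{-C_3\,\frac n{q^3}\Bigr\}\Bigr)\Bigl(1-\frac1{p^\nu}\Bigr),$$ the maximum likelihood estimator $\hat\beta_J$ exists for every $J\subseteq[p]$ with $|J|\le q$, and $J_0$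 is the unique minimizer of $\mathrm{BIC}_\gamma(J)$ over all $J\subseteq[p]$ with $|J|\le q$. -/

import Mathlib

open MeasureTheory ProbabilityTheory

noncomputable section

namespace LogisticEBIC

/-- The support `{j : u_j ≠ 0}` of a vector `u ∈ ℝ^p`. -/
def supp {p : ℕ} (u : EuclideanSpace ℝ (Fin p)) : Finset (Fin p) :=
  {j | u j ≠ 0}

/-- `(X_i, Y_i)`, `i = 1, …, n`, are i.i.d. pairs of a covariate vector and a binary response
that follow the logistic regression model with parameter `β₀`: the conditional probability `π`
of `Y_i = 1` given `X_i` satisfies `log (π / (1 - π)) = X_iᵀ β₀`. -/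
structure IsLogisticSample {Ω : Type*} [MeasurableSpace Ω] (μ : Measure Ω) {n p : ℕ}
    (X : Fin n → Ω → EuclideanSpace ℝ (Fin p)) (Y : Fin n → Ω → ℝ)
    (β₀ : EuclideanSpace ℝ (Fin p)) : Prop where
  measurable_X : ∀ i, Measurable (X i)
  measurable_Y : ∀ i, Measurable (Y i)
  binary : ∀ i ω, Y i ω = 0 ∨ Y i ω = 1
  indep : iIndepFun (fun i ω => (X i ω, Y i ω)) μ
  identDistrib : ∀ i k, IdentDistrib (fun ω => (X i ω, Y i ω)) (fun ω => (X k ω, Y k ω)) μ μ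
  logit : ∀ i, ∀ᵐ ω ∂μ,
    0 < (μ⟦Y i ⁻¹' {1} | MeasurableSpace.comap (X i) inferInstance⟧) ω ∧
    (μ⟦Y i ⁻¹' {1} | MeasurableSpace.comap (X i) inferInstance⟧) ω < 1 ∧
    Real.log ((μ⟦Y i ⁻¹' {1} | MeasurableSpace.comap (X i) inferInstance⟧) ω /
      (1 - (μ⟦Y i ⁻¹' {1} | MeasurableSpace.comap (X i) inferInstance⟧) ω))
      = inner ℝ (X i ω) β₀

/-- Conditions (A1), (A2), (A3) on a random covariate vector, with respect to the
sparsity level `q` and the constants `a₁`, `a₂`, `a₃`. -/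
structure CovariateConditions {Ω : Type*} [MeasurableSpace Ω] (μ : Measure Ω) {p : ℕ}
    (X₁ : Ω → EuclideanSpace ℝ (Fin p)) (q : ℕ) (a₁ a₂ a₃ : ℝ) : Prop where
  second_moment : ∀ u : EuclideanSpace ℝ (Fin p), (supp u).card ≤ q → ‖u‖ = 1 →
    a₁ ≤ ∫ ω, (inner ℝ (X₁ ω) u) ^ 2 ∂μ
  third_moment : ∀ u : EuclideanSpace ℝ (Fin p), (supp u).card ≤ q → ‖u‖ = 1 →
    ∫ ω, |inner ℝ (X₁ ω) u| ^ 3 ∂μ ≤ a₂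
  bounded : ∀ j, ∀ᵐ ω ∂μ, |X₁ ω j| ≤ a₃

/-- The cumulant function `b(θ) = log (1 + e^θ)`. -/
def cumulant (θ : ℝ) : ℝ := Real.log (1 + Real.exp θ)

/-- The log-likelihood function of the logistic regression model for the data `(x, y)`. -/
def logLik {n p : ℕ} (x : Fin n → EuclideanSpace ℝ (Fin p)) (y : Fin n → ℝ)
    (β : EuclideanSpace ℝ (Fin p)) : ℝ :=
  ∑ i, (y i * inner ℝ (x i) β - cumulant (inner ℝ (x i) β))

/-- `β` is a maximum likelihood estimator in the submodel given by `J`. The parameter space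
`ℝ^J` is identified with the vectors in `ℝ^p` whose support is contained in `J`. -/
def IsMLE {n p : ℕ} (x : Fin n → EuclideanSpace ℝ (Fin p)) (y : Fin n → ℝ)
    (J : Finset (Fin p)) (β : EuclideanSpace ℝ (Fin p)) : Prop :=
  supp β ⊆ J ∧ ∀ β' : EuclideanSpace ℝ (Fin p), supp β' ⊆ J → logLik x y β' ≤ logLik x y β

/-- The extended BIC score of the model `J`, computed with the estimator `βhat` of that model. -/
def ebic {n p : ℕ} (γ : ℝ) (x : Fin n → EuclideanSpace ℝ (Fin p)) (y : Fin n → ℝ)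
    (J : Finset (Fin p)) (βhat : EuclideanSpace ℝ (Fin p)) : ℝ :=
  -2 * logLik x y βhat + J.card * (Real.log n + 2 * γ * Real.log p)

/-- `J₀` is the unique minimizer of the extended BIC over all models of size at most `q`:
all these models have a maximum likelihood estimator, and the set of minimizers is `{J₀}`.
(The score does not depend on which maximum likelihood estimator of a model is used.) -/
def EBICSelects {n p : ℕ} (γ : ℝ) (q : ℕ) (x : Fin n → EuclideanSpace ℝ (Fin p))
    (y : Fin n → ℝ) (J₀ : Finset (Fin p)) : Prop :=
  ∃ βhat : Finset (Fin p) → EuclideanSpace ℝ (Fin p),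
    (∀ J : Finset (Fin p), J.card ≤ q → IsMLE x y J (βhat J)) ∧
    {J : Finset (Fin p) | J.card ≤ q ∧ ∀ J' : Finset (Fin p), J'.card ≤ q →
      ebic γ x y J (βhat J) ≤ ebic γ x y J' (βhat J')} = {J₀}

end LogisticEBIC

end

open MeasureTheory ProbabilityTheory

namespace LogisticEBIC

/-! ### Nets of unit balls by volume comparison -/

section Nets

open Metric Module ENNReal

/-! Condition on the covariates. Let T be the design map weighted by the square roots of the
Bernoulli variances at β₀, and ξ the standardized residuals. To second order, 2(ℓ(β₀+u) − ℓ(β₀)) is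
2⟨ξ, Tu⟩ − ‖Tu‖² (`quadGain`), with error at most 2 ∑ |xᵢᵀu|³. Adding the variables K to J₀
therefore raises the maximum of the quadratic by at most the squared norm of the projection of ξ
onto a space of dimension at most |K|. A Chernoff bound on a net (`respProb_projection_le`) shows
that this exceeds |K|s, where s = 2(1+ε/2)(1+ν) log p, with probability at most r^|K|, r being a
constant times a power of p below −(1+ν). Summing over all K costs about 2pr, and the whole response
event fails with probability at most p^(−ν) (`respProb_not_goodResponse_le`, `response_failure_le`).

On this event the selection is deterministic (`ebicSelects_of_good`). For a model containing J₀ the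
estimator lies within r₁, of order √(q log p / n), of β₀. Its advantage over J₀ is at most s per
extra variable plus cubic errors of order n r₁³, which are a small multiple of log p as soon as n is
a large multiple of q³ log p. The penalty per variable exceeds 2(1+ε)(1+ν) log p by the assumption
on √n, so it wins. A model missing some j in J₀ keeps its estimator at distance at least |β₀ j| from
β₀; curvature near β₀ and concavity further out force a loss of log-likelihood that the smaller
penalty cannot repay.

What is needed of the covariates is curvature and a cubic bound, uniformly over 2q-sparse vectors.
Both come from Chernoff bounds for bounded variables and a union over nets
(`le_measureReal_goodDesign`). Since the response bound is conditional on the covariates, the two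
success probabilities multiply (`IsLogisticSample.le_measureReal`). -/

/-- The balls of radius `δ / 2` about the points are disjoint and lie in the ball of radius `1 + δ /
2`; compare volumes. -/
theorem card_le_of_separated {E : Type*} [NormedAddCommGroup E] [NormedSpace ℝ E]
    [FiniteDimensional ℝ E] {δ : ℝ} (hδ : 0 < δ) (s : Finset E) (hs : ∀ c ∈ s, ‖c‖ ≤ 1)
    (h : ∀ c ∈ s, ∀ d ∈ s, c ≠ d → δ ≤ ‖c - d‖) :
    (s.card : ℝ) ≤ (1 + 2 / δ) ^ finrank ℝ E := by
  borelize E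
  let μ : Measure E := Measure.addHaar
  have hδ2 : 0 < δ / 2 := by positivity
  have ρpos : 0 < 1 + δ / 2 := by positivity
  have D : Set.Pairwise (s : Set E) (Function.onFun Disjoint fun c => ball (c : E) (δ / 2)) := by
    rintro c hc d hd hcd
    apply ball_disjoint_ball
    rw [dist_eq_norm]
    linarith [h c hc d hd hcd]
  have A_subset : (⋃ c ∈ s, ball (c : E) (δ / 2)) ⊆ ball (0 : E) (1 + δ / 2) := by
    refine Set.iUnion₂_subset fun x hx => ball_subset_ball' ?_
    rw [dist_zero_right]
    linarith [hs x hx]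
  have I : (s.card : ℝ≥0∞) * ENNReal.ofReal ((δ / 2) ^ finrank ℝ E) * μ (ball 0 1) ≤
      ENNReal.ofReal ((1 + δ / 2) ^ finrank ℝ E) * μ (ball 0 1) :=
    calc
      _ = μ (⋃ c ∈ s, ball (c : E) (δ / 2)) := by
        rw [measure_biUnion_finset D fun c _ => measurableSet_ball]
        simp only [μ.addHaar_ball_of_pos _ hδ2]
        simp only [Finset.sum_const, nsmul_eq_mul, mul_assoc]
      _ ≤ μ (ball (0 : E) (1 + δ / 2)) := measure_mono A_subset
      _ = _ := by simp only [μ.addHaar_ball_of_pos _ ρpos]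
  have J : (s.card : ℝ≥0∞) * ENNReal.ofReal ((δ / 2) ^ finrank ℝ E)
      ≤ ENNReal.ofReal ((1 + δ / 2) ^ finrank ℝ E) :=
    (ENNReal.mul_le_mul_iff_left (measure_ball_pos _ _ zero_lt_one).ne' measure_ball_lt_top.ne).1 I
  have K := ENNReal.toReal_le_of_le_ofReal (pow_nonneg ρpos.le _) J
  rw [ENNReal.toReal_mul, ENNReal.toReal_natCast, ENNReal.toReal_ofReal (by positivity)] at K
  have : (1 + 2 / δ) = (1 + δ / 2) / (δ / 2) := by field_simp; ring
  rw [this, div_pow, le_div_iff₀ (by positivity)]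
  exact K

/-- A `δ`-net of the unit ball of cardinality at most `(1 + 2/δ)^k`. -/
theorem exists_net {E : Type*} [NormedAddCommGroup E] [NormedSpace ℝ E]
    [FiniteDimensional ℝ E] {δ : ℝ} (hδ : 0 < δ) :
    ∃ s : Finset E, (∀ c ∈ s, ‖c‖ ≤ 1) ∧ (s.card : ℝ) ≤ (1 + 2 / δ) ^ finrank ℝ E ∧
      ∀ u : E, ‖u‖ ≤ 1 → ∃ c ∈ s, ‖u - c‖ ≤ δ := by
  classical
  -- A `δ`-separated set of largest cardinality is a net, since an uncovered point could be added to
  -- it. The volume bound makes the cardinalities bounded.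
  let P : ℕ → Prop := fun m => ∃ s : Finset E, s.card = m ∧ (∀ c ∈ s, ‖c‖ ≤ 1) ∧
    ∀ c ∈ s, ∀ d ∈ s, c ≠ d → δ ≤ ‖c - d‖
  have hP0 : ∃ m, P m := ⟨0, ∅, by simp⟩
  have hb : ∀ m, P m → m ≤ ⌊(1 + 2 / δ) ^ finrank ℝ E⌋₊ := by
    rintro m ⟨s, rfl, h1, h2⟩
    exact Nat.le_floor (card_le_of_separated hδ s h1 h2)
  have hmem : P (sSup {m | P m}) := Nat.sSup_mem (s := {m | P m}) hP0 ⟨_, hb⟩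
  obtain ⟨s, hs, h1, h2⟩ := hmem
  refine ⟨s, h1, card_le_of_separated hδ s h1 h2, fun u hu => ?_⟩
  by_contra! hc
  have hus : u ∉ s := fun h => by
    have := hc u h
    simp at this
    linarith
  have : P (s.card + 1) := by
    refine ⟨insert u s, Finset.card_insert_of_notMem hus, ?_, ?_⟩
    · intro c hc'
      rcases Finset.mem_insert.1 hc' with rfl | h
      exacts [hu, h1 c h]
    · intro c hc' d hd hcd
      rcases Finset.mem_insert.1 hc' with rfl | h <;> rcases Finset.mem_insert.1 hd with rfl | h'
      · exact absurd rfl hcd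
      · exact (hc d h').le
      · rw [norm_sub_rev]; exact (hc c h).le
      · exact h2 c h d h' hcd
  have := le_csSup (s := {m | P m}) ⟨_, hb⟩ this
  omega

theorem exists_net_submodule {E : Type*} [NormedAddCommGroup E] [NormedSpace ℝ E]
    (W : Submodule ℝ E) [FiniteDimensional ℝ W] {δ : ℝ} (hδ : 0 < δ) :
    ∃ s : Finset E, (∀ c ∈ s, c ∈ W ∧ ‖c‖ ≤ 1) ∧ (s.card : ℝ) ≤ (1 + 2 / δ) ^ finrank ℝ W ∧
      ∀ u ∈ W, ‖u‖ ≤ 1 → ∃ c ∈ s, ‖u - c‖ ≤ δ := by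
  obtain ⟨s, h1, h2, h3⟩ := exists_net (E := W) hδ
  refine ⟨s.map ⟨Subtype.val, Subtype.val_injective⟩, ?_, by simpa using h2, ?_⟩
  · intro c hc
    simp only [Finset.mem_map, Function.Embedding.coeFn_mk] at hc
    obtain ⟨a, ha, rfl⟩ := hc
    exact ⟨a.2, by simpa using h1 a ha⟩
  · intro u hu hu1
    obtain ⟨c, hc, h⟩ := h3 ⟨u, hu⟩ (by simpa using hu1)
    exact ⟨c, by simpa using hc, by simpa using h⟩

end Nets

/-! ### Counting subsets -/

section Counting

theorem sum_pow_card (p : ℕ) (r : ℝ) :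
    ∑ K : Finset (Fin p), r ^ K.card = (1 + r) ^ p := by
  have := Finset.prod_one_add (f := fun _ : Fin p => r) Finset.univ
  simpa using this.symm

/-- Turns a sum of `r ^ K.card` over all sets `K` into a bound linear in `p * r`, from `exp z ≤ 1 +
z + z ^ 2` on `[0, 1]`. -/
theorem one_add_pow_le {p : ℕ} {r : ℝ} (hr : 0 ≤ r) (h : p * r ≤ 1) :
    (1 + r) ^ p ≤ 1 + 2 * (p * r) := by
  have h1 : (1 + r) ^ p ≤ Real.exp (p * r) := by
    rw [Real.exp_nat_mul]
    gcongr
    linarith [Real.add_one_le_exp r]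
  have h2 : (0 : ℝ) ≤ p * r := by positivity
  have h3 := Real.abs_exp_sub_one_sub_id_le (x := p * r) (by rwa [abs_of_nonneg h2])
  have h4 := (abs_le.1 h3).2
  nlinarith

/-- Each counted set has weight `p ^ m * (1 / p) ^ J.card ≥ 1`, and the weights of all sets sum to
`p ^ m * (1 + 1 / p) ^ p`. -/
theorem card_finset_card_le {p : ℕ} (hp : 0 < p) (m : ℕ) :
    ((Finset.univ.filter fun J : Finset (Fin p) => J.card ≤ m).card : ℝ) ≤ 3 * (p : ℝ) ^ m := by
  have hp1 : (1 : ℝ) ≤ p := by exact_mod_cast hp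
  calc ((Finset.univ.filter fun J : Finset (Fin p) => J.card ≤ m).card : ℝ)
      = ∑ J ∈ Finset.univ.filter fun J : Finset (Fin p) => J.card ≤ m, (1 : ℝ) := by simp
    _ ≤ ∑ J ∈ Finset.univ.filter fun J : Finset (Fin p) => J.card ≤ m,
          (p : ℝ) ^ m * (1 / p) ^ J.card := by
        refine Finset.sum_le_sum fun J hJ => ?_
        rw [div_pow, one_pow, mul_one_div, le_div_iff₀ (by positivity), one_mul]
        exact pow_le_pow_right₀ hp1 (Finset.mem_filter.1 hJ).2
    _ ≤ ∑ J : Finset (Fin p), (p : ℝ) ^ m * (1 / p) ^ J.card :=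
        Finset.sum_le_sum_of_subset_of_nonneg (Finset.filter_subset _ _)
          fun _ _ _ => by positivity
    _ = (p : ℝ) ^ m * (1 + 1 / p) ^ p := by rw [← Finset.mul_sum, sum_pow_card]
    _ ≤ 3 * (p : ℝ) ^ m := by
        have : (p : ℝ) * (1 / p) = 1 := by field_simp
        have := one_add_pow_le (p := p) (r := 1 / p) (by positivity) this.le
        rw [mul_comm]
        gcongr
        linarith

end Counting

end LogisticEBIC

noncomputable section

namespace LogisticEBIC

/-! ### The logistic cumulant function and Bernoulli moment generating functions -/

section Cumulant

open Real

/-- The variance function `b''(θ) = σ(θ) (1 - σ(θ))`. -/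
def varFun (θ : ℝ) : ℝ := sigmoid θ * (1 - sigmoid θ)

theorem varFun_pos (θ : ℝ) : 0 < varFun θ :=
  mul_pos (sigmoid_pos θ) (by linarith [sigmoid_lt_one θ])

theorem varFun_le_one (θ : ℝ) : varFun θ ≤ 1 :=
  mul_le_one₀ (sigmoid_le_one θ) (by linarith [sigmoid_lt_one θ]) (by linarith [sigmoid_pos θ])

theorem continuous_varFun : Continuous varFun := by
  unfold varFun
  have := continuous_sigmoid
  fun_prop

theorem one_sub_sigmoid (θ : ℝ) : 1 - sigmoid θ = (1 + exp θ)⁻¹ := by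
  rw [← sigmoid_neg, sigmoid_def, neg_neg]

theorem sigmoid_eq (θ : ℝ) : sigmoid θ = exp θ * (1 + exp θ)⁻¹ := by
  rw [sigmoid_def, exp_neg]
  have := exp_pos θ
  field_simp
  ring

theorem varFun_eq (θ : ℝ) : varFun θ = (2 + exp θ + exp (-θ))⁻¹ := by
  rw [varFun, one_sub_sigmoid, sigmoid_eq, exp_neg]
  have := exp_pos θ
  field_simp
  ring

/-- In `1 / (2 + e^θ + e^(-θ))` a shift by `h` changes each term of the denominator by a factor of
at least `e^(-|h|)`. -/
theorem varFun_add_le (θ h : ℝ) : varFun (θ + h) ≤ varFun θ * exp |h| := by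
  rw [varFun_eq, varFun_eq, ← div_eq_inv_mul, ← one_div, div_le_div_iff₀ (by positivity)
    (by positivity), one_mul]
  have h1 : exp θ ≤ exp |h| * exp (θ + h) := by
    rw [← exp_add]; exact exp_le_exp.2 (by linarith [neg_abs_le h])
  have h2 : exp (-θ) ≤ exp |h| * exp (-(θ + h)) := by
    rw [← exp_add]; exact exp_le_exp.2 (by linarith [le_abs_self h])
  have h3 : 1 ≤ exp |h| := one_le_exp (abs_nonneg h)
  linarith

theorem varFun_mono_abs {θ B : ℝ} (h : |θ| ≤ B) : varFun B ≤ varFun θ := by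
  rw [varFun_eq, varFun_eq]
  have h1 : exp θ + exp (-θ) ≤ exp B + exp (-B) := by
    have := cosh_le_cosh.2 (h.trans (le_abs_self B))
    rw [cosh_eq, cosh_eq] at this
    linarith
  gcongr ?_⁻¹
  linarith

theorem hasDerivAt_cumulant (θ : ℝ) : HasDerivAt cumulant (sigmoid θ) θ := by
  have h := ((hasDerivAt_exp θ).const_add 1).log (by positivity)
  rw [sigmoid_eq, ← div_eq_mul_inv]
  exact h

theorem hasDerivAt_sigmoid' (θ : ℝ) : HasDerivAt sigmoid (varFun θ) θ :=
  hasDerivAt_sigmoid θ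

/-- With `a`, `b` the two sigmoid values, the difference factors as `(a - b) (1 - a - b)`; the
sigmoid is 1-Lipschitz and the second factor has modulus at most 1. -/
theorem abs_varFun_add_sub_le (θ h : ℝ) : |varFun (θ + h) - varFun θ| ≤ |h| := by
  have hlip : |sigmoid (θ + h) - sigmoid θ| ≤ |h| := by
    have := Convex.norm_image_sub_le_of_norm_hasDerivWithin_le (f := sigmoid) (f' := varFun)
      (s := Set.univ) (C := 1) (x := θ) (y := θ + h)
      (fun x _ => (hasDerivAt_sigmoid' x).hasDerivWithinAt)
      (fun x _ => by rw [norm_eq_abs, abs_of_pos (varFun_pos x)]; exact varFun_le_one x)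
      convex_univ (Set.mem_univ _) (Set.mem_univ _)
    simpa using this
  have e : varFun (θ + h) - varFun θ
      = (sigmoid (θ + h) - sigmoid θ) * (1 - sigmoid (θ + h) - sigmoid θ) := by
    unfold varFun; ring
  rw [e, abs_mul]
  have h2 : |1 - sigmoid (θ + h) - sigmoid θ| ≤ 1 := by
    rw [abs_le]
    constructor <;> linarith [sigmoid_pos θ, sigmoid_pos (θ + h), sigmoid_lt_one θ,
      sigmoid_lt_one (θ + h)]
  calc _ ≤ |h| * 1 := mul_le_mul hlip h2 (abs_nonneg _) (abs_nonneg _)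
    _ = |h| := mul_one _

/-- Second order Taylor expansion of the cumulant function, with Lagrange remainder. -/
theorem exists_cumulant_add (θ h : ℝ) : ∃ s : ℝ, |s| ≤ |h| ∧
    cumulant (θ + h) = cumulant θ + h * sigmoid θ + h ^ 2 / 2 * varFun (θ + s) := by
  rcases eq_or_ne h 0 with rfl | hh
  · exact ⟨0, by simp⟩
  set g : ℝ → ℝ := fun t => cumulant (θ + t * h) with hg
  set r : ℝ → ℝ := fun t => g t - g 0 - t * (h * sigmoid θ) with hr
  have hg1 : ∀ t, HasDerivAt r (h * sigmoid (θ + t * h) - h * sigmoid θ) t := fun t => by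
    have h1 : HasDerivAt (fun t : ℝ => θ + t * h) h t := by
      simpa using ((hasDerivAt_id t).mul_const h).const_add θ
    have h2 := (hasDerivAt_cumulant (θ + t * h)).comp t h1
    have h3 := (h2.sub_const (g 0)).sub ((hasDerivAt_id t).mul_const (h * sigmoid θ))
    exact HasDerivAt.congr_deriv h3 (by ring)
  have hg2 : ∀ t, HasDerivAt (fun t => h * sigmoid (θ + t * h) - h * sigmoid θ)
      (h ^ 2 * varFun (θ + t * h)) t := fun t => by
    have h1 : HasDerivAt (fun t : ℝ => θ + t * h) h t := by
      simpa using ((hasDerivAt_id t).mul_const h).const_add θ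
    have h2 := (((hasDerivAt_sigmoid' (θ + t * h)).comp t h1).const_mul h).sub_const
      (h * sigmoid θ)
    exact HasDerivAt.congr_deriv h2 (by ring)
  have hrc : Continuous r := continuous_iff_continuousAt.2 fun t => (hg1 t).continuousAt
  -- Cauchy's mean value theorem for the remainder `r` against `t ^ 2` on `[0, 1]`; the ordinary one
  -- for the derivative of `r` on `[0, t]` then produces the second derivative.
  obtain ⟨t, ht, het⟩ := exists_ratio_hasDerivAt_eq_ratio_slope r _ zero_lt_one
    hrc.continuousOn (fun t _ => hg1 t) (fun t => t ^ 2) (fun t => 2 * t)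
    (continuous_pow 2).continuousOn (fun t _ => by simpa using hasDerivAt_pow 2 t)
  have hc2 : Continuous (fun t => h * sigmoid (θ + t * h) - h * sigmoid θ) :=
    continuous_iff_continuousAt.2 fun t => (hg2 t).continuousAt
  obtain ⟨s, hs, hes⟩ := exists_hasDerivAt_eq_slope (fun t => h * sigmoid (θ + t * h)
    - h * sigmoid θ) (fun t => h ^ 2 * varFun (θ + t * h)) ht.1 hc2.continuousOn
    (fun t _ => hg2 t)
  refine ⟨s * h, ?_, ?_⟩
  · rw [abs_mul, abs_of_pos hs.1]
    exact mul_le_of_le_one_left (abs_nonneg h) (hs.2.trans ht.2).le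
  · have ht0 := ht.1
    rw [eq_div_iff (by linarith)] at hes
    simp only [zero_mul, add_zero, sub_self, sub_zero] at hes
    have hr0 : r 0 = 0 := by simp [hr]
    have hr1 : r 1 = cumulant (θ + h) - cumulant θ - h * sigmoid θ := by simp [hr, hg]
    rw [hr0, hr1] at het
    norm_num at het
    rw [← hes] at het
    have : 2 * (cumulant (θ + h) - cumulant θ - h * sigmoid θ) = h ^ 2 * varFun (θ + s * h) := by
      apply mul_left_cancel₀ ht0.ne'
      linarith
    linarith

theorem cumulant_add_le (θ h : ℝ) :
    cumulant (θ + h) ≤ cumulant θ + h * sigmoid θ + h ^ 2 / 2 * (varFun θ * exp |h|) := by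
  obtain ⟨s, hs, e⟩ := exists_cumulant_add θ h
  rw [e]
  have h1 : varFun (θ + s) ≤ varFun θ * exp |h| := (varFun_add_le θ s).trans <|
    mul_le_mul_of_nonneg_left (exp_le_exp.2 hs) (varFun_pos θ).le
  gcongr

theorem abs_cumulant_taylor_le (θ h : ℝ) :
    |cumulant (θ + h) - cumulant θ - h * sigmoid θ - h ^ 2 / 2 * varFun θ| ≤ |h| ^ 3 := by
  obtain ⟨s, hs, e⟩ := exists_cumulant_add θ h
  have e2 : cumulant (θ + h) - cumulant θ - h * sigmoid θ - h ^ 2 / 2 * varFun θ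
      = h ^ 2 / 2 * (varFun (θ + s) - varFun θ) := by rw [e]; ring
  rw [e2, abs_mul, abs_of_nonneg (by positivity : 0 ≤ h ^ 2 / 2)]
  calc h ^ 2 / 2 * |varFun (θ + s) - varFun θ| ≤ h ^ 2 / 2 * |h| := by
        exact mul_le_mul_of_nonneg_left ((abs_varFun_add_sub_le θ s).trans hs) (by positivity)
    _ = |h| ^ 3 / 2 := by rw [← sq_abs]; ring
    _ ≤ |h| ^ 3 := by linarith [pow_nonneg (abs_nonneg h) 3]

theorem convexOn_cumulant : ConvexOn ℝ Set.univ cumulant := by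
  have hd : deriv cumulant = sigmoid := funext fun x => (hasDerivAt_cumulant x).deriv
  refine MonotoneOn.convexOn_of_deriv convex_univ
    (fun x _ => (hasDerivAt_cumulant x).continuousAt.continuousWithinAt)
    (fun x _ => (hasDerivAt_cumulant x).differentiableAt.differentiableWithinAt) ?_
  rw [hd]
  exact sigmoid_monotone.monotoneOn _

theorem continuous_cumulant : Continuous cumulant :=
  continuous_iff_continuousAt.2 fun x => (hasDerivAt_cumulant x).continuousAt

/-- The exponential family identity: the log-moment generating function is an increment of the
cumulant, so Taylor bounds on the cumulant become mgf bounds. -/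
theorem bernoulli_mgf (θ h : ℝ) :
    sigmoid θ * exp h + (1 - sigmoid θ) = exp (cumulant (θ + h) - cumulant θ) := by
  rw [cumulant, cumulant, exp_sub, exp_log (by positivity), exp_log (by positivity),
    one_sub_sigmoid, sigmoid_eq, exp_add]
  have := exp_pos θ
  field_simp
  ring

/-- Bound on the moment generating function of a centred Bernoulli variable. -/
theorem bernoulli_centered_mgf_le (θ h : ℝ) :
    sigmoid θ * exp (h * (1 - sigmoid θ)) + (1 - sigmoid θ) * exp (h * (0 - sigmoid θ))
      ≤ exp (h ^ 2 / 2 * (varFun θ * exp |h|)) := by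
  have e : sigmoid θ * exp (h * (1 - sigmoid θ)) + (1 - sigmoid θ) * exp (h * (0 - sigmoid θ))
      = (sigmoid θ * exp h + (1 - sigmoid θ)) * exp (-(h * sigmoid θ)) := by
    rw [mul_sub, exp_sub, exp_neg, mul_sub, mul_zero, zero_sub, exp_neg, mul_one]
    ring
  rw [e, bernoulli_mgf, ← exp_add]
  exact exp_le_exp.2 (by linarith [cumulant_add_le θ h])

end Cumulant

/-! ### Independent Bernoulli responses and tails of residual projections -/

section Response

open Real
open scoped Classical in
/-- The probability, under independent responses with success probabilities `σ(θ_i)`, of the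
set `B` of response vectors. -/
def respProb {n : ℕ} (θ : Fin n → ℝ) (B : (Fin n → Bool) → Prop) : ℝ :=
  ∑ y with B y, ∏ i, if y i then sigmoid (θ i) else 1 - sigmoid (θ i)

/-- A binary response as a real number. -/
def resp {n : ℕ} (y : Fin n → Bool) (i : Fin n) : ℝ := if y i then 1 else 0

theorem respWeight_nonneg {n : ℕ} (θ : Fin n → ℝ) (y : Fin n → Bool) :
    0 ≤ ∏ i, if y i then sigmoid (θ i) else 1 - sigmoid (θ i) :=
  Finset.prod_nonneg fun i _ => by
    split_ifs
    · exact sigmoid_nonneg _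
    · linarith [sigmoid_le_one (θ i)]

/-- Independence: the expectation of a product over coordinates factors, by expanding a product of
two-term sums. -/
theorem sum_respWeight_mul {n : ℕ} (θ : Fin n → ℝ) (f : Fin n → Bool → ℝ) :
    ∑ y : Fin n → Bool, (∏ i, if y i then sigmoid (θ i) else 1 - sigmoid (θ i)) * ∏ i, f i (y i)
      = ∏ i, (sigmoid (θ i) * f i true + (1 - sigmoid (θ i)) * f i false) := by
  have := Finset.prod_univ_sum (fun _ : Fin n => (Finset.univ : Finset Bool))
    (fun i b => (if b then sigmoid (θ i) else 1 - sigmoid (θ i)) * f i b)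
  simp only [Fintype.sum_bool, Fintype.piFinset_univ, if_true, Bool.false_eq_true, if_false]
    at this
  rw [this]
  simp only [Finset.prod_mul_distrib]

theorem respProb_true {n : ℕ} (θ : Fin n → ℝ) : respProb θ (fun _ => True) = 1 := by
  have := sum_respWeight_mul θ (fun _ _ => 1)
  simpa [respProb] using this

theorem respProb_mono {n : ℕ} (θ : Fin n → ℝ) {B B' : (Fin n → Bool) → Prop}
    (h : ∀ y, B y → B' y) : respProb θ B ≤ respProb θ B' := by
  unfold respProb
  refine Finset.sum_le_sum_of_subset_of_nonneg ?_ fun y _ _ => respWeight_nonneg θ y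
  intro y hy
  simp only [Finset.mem_filter, Finset.mem_univ, true_and] at hy ⊢
  exact h y hy

theorem respProb_compl {n : ℕ} (θ : Fin n → ℝ) (B : (Fin n → Bool) → Prop) :
    respProb θ B = 1 - respProb θ (fun y => ¬ B y) := by
  classical
  rw [eq_sub_iff_add_eq, ← respProb_true θ]
  unfold respProb
  rw [Finset.sum_filter_add_sum_filter_not]
  simp only [Finset.filter_true]

/-- Markov's inequality, used with an exponential for the Chernoff bound and with a sum of
indicators for the union bound. -/
theorem respProb_le_sum {n : ℕ} (θ : Fin n → ℝ) (f : (Fin n → Bool) → ℝ) (hf : ∀ y, 0 ≤ f y)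
    (B : (Fin n → Bool) → Prop) (h : ∀ y, B y → 1 ≤ f y) :
    respProb θ B ≤
      ∑ y : Fin n → Bool, (∏ i, if y i then sigmoid (θ i) else 1 - sigmoid (θ i)) * f y := by
  classical
  unfold respProb
  calc _ ≤ ∑ y with B y, (∏ i, if y i then sigmoid (θ i) else 1 - sigmoid (θ i)) * f y :=
        Finset.sum_le_sum fun y hy => le_mul_of_one_le_right (respWeight_nonneg θ y)
          (h y (Finset.mem_filter.1 hy).2)
    _ ≤ _ := Finset.sum_le_sum_of_subset_of_nonneg (Finset.filter_subset _ _)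
        fun y _ _ => mul_nonneg (respWeight_nonneg θ y) (hf y)

theorem respProb_biUnion_le {n : ℕ} {ι : Type*} (θ : Fin n → ℝ) (s : Finset ι)
    (B : ι → (Fin n → Bool) → Prop) :
    respProb θ (fun y => ∃ i ∈ s, B i y) ≤ ∑ i ∈ s, respProb θ (B i) := by
  classical
  have h := respProb_le_sum θ (fun y => ∑ i ∈ s, if B i y then (1 : ℝ) else 0)
    (fun y => Finset.sum_nonneg fun i _ => by split_ifs <;> norm_num)
    (fun y => ∃ i ∈ s, B i y) (by
      rintro y ⟨i, hi, hB⟩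
      have := Finset.single_le_sum (f := fun i => if B i y then (1 : ℝ) else 0)
        (fun i _ => by split_ifs <;> norm_num) hi
      simpa [hB] using this)
  refine h.trans (le_of_eq ?_)
  simp only [Finset.mul_sum]
  rw [Finset.sum_comm]
  refine Finset.sum_congr rfl fun i _ => ?_
  unfold respProb
  rw [Finset.sum_filter]
  refine Finset.sum_congr rfl fun y _ => ?_
  split_ifs <;> simp

theorem respProb_or_le {n : ℕ} (θ : Fin n → ℝ) (B B' : (Fin n → Bool) → Prop) :
    respProb θ (fun y => B y ∨ B' y) ≤ respProb θ B + respProb θ B' := by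
  have h := respProb_biUnion_le θ Finset.univ (fun b : Bool => if b then B else B')
  simp only [Fintype.sum_bool, if_true, Bool.false_eq_true, if_false] at h
  refine (respProb_mono θ ?_).trans h
  rintro y (hy | hy)
  · exact ⟨true, by simp, by simpa using hy⟩
  · exact ⟨false, by simp, by simpa using hy⟩

/-- Chernoff bound for a weighted sum of centred Bernoulli variables. -/
theorem respProb_chernoff {n : ℕ} (θ a : Fin n → ℝ) {s t η : ℝ} (ht : 0 ≤ t)
    (ha : ∀ i, |a i| ≤ η) (hV : ∑ i, a i ^ 2 * varFun (θ i) ≤ 1) :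
    respProb θ (fun y => s ≤ ∑ i, a i * (resp y i - sigmoid (θ i)))
      ≤ exp (-(t * s) + t ^ 2 / 2 * exp (t * η)) := by
  have h := respProb_le_sum θ
    (fun y => exp (t * (∑ i, a i * (resp y i - sigmoid (θ i)) - s)))
    (fun y => (exp_pos _).le) (fun y => s ≤ ∑ i, a i * (resp y i - sigmoid (θ i)))
    (fun y hy => one_le_exp (mul_nonneg ht (by linarith)))
  refine h.trans ?_
  have e : ∀ y : Fin n → Bool, exp (t * (∑ i, a i * (resp y i - sigmoid (θ i)) - s))
      = exp (-(t * s)) *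
        ∏ i, exp (t * a i * ((if y i then (1 : ℝ) else 0) - sigmoid (θ i))) := fun y => by
    rw [← exp_sum, ← exp_add]
    congr 1
    rw [mul_sub, Finset.mul_sum]
    simp only [resp, mul_assoc]
    ring
  simp only [e]
  have e2 := sum_respWeight_mul θ
    (fun i b => exp (t * a i * ((if b then (1 : ℝ) else 0) - sigmoid (θ i))))
  calc _ = exp (-(t * s)) * ∏ i, (sigmoid (θ i) * exp (t * a i * (1 - sigmoid (θ i)))
          + (1 - sigmoid (θ i)) * exp (t * a i * (0 - sigmoid (θ i)))) := by
        simp only [if_true, Bool.false_eq_true, if_false] at e2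
        rw [← e2, Finset.mul_sum]
        exact Finset.sum_congr rfl fun y _ => by ring
    _ ≤ exp (-(t * s)) * ∏ i, exp ((t * a i) ^ 2 / 2 * (varFun (θ i) * exp |t * a i|)) := by
        refine mul_le_mul_of_nonneg_left (Finset.prod_le_prod (fun i _ => ?_)
          fun i _ => bernoulli_centered_mgf_le _ _) (exp_pos _).le
        have := sigmoid_pos (θ i)
        have := sigmoid_lt_one (θ i)
        exact add_nonneg (mul_nonneg (by linarith) (exp_pos _).le)
          (mul_nonneg (by linarith) (exp_pos _).le)
    _ = exp (-(t * s) + ∑ i, (t * a i) ^ 2 / 2 * (varFun (θ i) * exp |t * a i|)) := by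
        rw [← exp_sum, ← exp_add]
    _ ≤ _ := by
        refine exp_le_exp.2 (add_le_add le_rfl ?_)
        calc ∑ i, (t * a i) ^ 2 / 2 * (varFun (θ i) * exp |t * a i|)
            ≤ ∑ i, (t ^ 2 / 2 * exp (t * η)) * (a i ^ 2 * varFun (θ i)) := by
              refine Finset.sum_le_sum fun i _ => ?_
              have h1 : exp |t * a i| ≤ exp (t * η) := by
                rw [abs_mul, abs_of_nonneg ht]
                exact exp_le_exp.2 (mul_le_mul_of_nonneg_left (ha i) ht)
              calc _ = t ^ 2 / 2 * exp |t * a i| * (a i ^ 2 * varFun (θ i)) := by ring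
                _ ≤ _ := by
                  have := (varFun_pos (θ i)).le
                  gcongr
          _ = t ^ 2 / 2 * exp (t * η) * ∑ i, a i ^ 2 * varFun (θ i) := by
              rw [← Finset.mul_sum]
          _ ≤ t ^ 2 / 2 * exp (t * η) := mul_le_of_le_one_right (by positivity) hV

/-- The standardized residual vector. -/
def residual {n : ℕ} (θ : Fin n → ℝ) (y : Fin n → ℝ) : EuclideanSpace ℝ (Fin n) :=
  WithLp.toLp 2 fun i => (y i - sigmoid (θ i)) / √(varFun (θ i))

theorem inner_residual {n : ℕ} (θ y : Fin n → ℝ) (w : EuclideanSpace ℝ (Fin n)) :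
    inner ℝ (residual θ y) w = ∑ i, w i / √(varFun (θ i)) * (y i - sigmoid (θ i)) := by
  rw [PiLp.inner_apply]
  refine Finset.sum_congr rfl fun i _ => ?_
  simp only [residual, RCLike.inner_apply, conj_trivial]
  ring

theorem inner_le_norm_starProjection {E : Type*} [NormedAddCommGroup E] [InnerProductSpace ℝ E]
    (W : Submodule ℝ E) [W.HasOrthogonalProjection] (x : E) {w : E} (hw : w ∈ W) :
    inner ℝ x w ≤ ‖W.starProjection x‖ * ‖w‖ := by
  have : inner ℝ x w = inner ℝ (W.starProjection x) w := by
    rw [Submodule.inner_starProjection_left_eq_right, Submodule.starProjection_eq_self_iff.2 hw]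
  rw [this]
  exact real_inner_le_norm _ _

/-- The unit vector `u` along the projection has inner product `ρ` with `x`. A net point `c` near it
loses at most `ρ * δ`, because `u - c` lies in `W` and so only sees the projection of `x`. -/
theorem exists_net_point_of_lt_norm_starProjection {E : Type*} [NormedAddCommGroup E]
    [InnerProductSpace ℝ E] (W : Submodule ℝ E) [W.HasOrthogonalProjection] {δ τ : ℝ}
    (hτ : 0 ≤ τ) (s : Finset E) (hs : ∀ c ∈ s, c ∈ W)
    (hnet : ∀ u ∈ W, ‖u‖ ≤ 1 → ∃ c ∈ s, ‖u - c‖ ≤ δ) {x : E} (hx : τ < ‖W.starProjection x‖)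
    (hδ : δ ≤ 1) : ∃ c ∈ s, (1 - δ) * τ ≤ inner ℝ x c := by
  set ρ := ‖W.starProjection x‖ with hρ
  have hρ0 : 0 < ρ := hτ.trans_lt hx
  set u := ρ⁻¹ • W.starProjection x with hu
  have huW : u ∈ W := W.smul_mem _ (W.starProjection_apply_mem x)
  obtain ⟨c, hc, hcu⟩ := hnet u huW (by
    rw [hu, norm_smul, norm_inv, norm_of_nonneg hρ0.le, ← hρ, inv_mul_cancel₀ hρ0.ne'])
  refine ⟨c, hc, ?_⟩
  have h1 : inner ℝ x u = ρ := by
    rw [hu, inner_smul_right, ← Submodule.starProjection_eq_self_iff.2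
      (W.starProjection_apply_mem x), ← Submodule.inner_starProjection_left_eq_right,
      real_inner_self_eq_norm_sq, ← hρ]
    field_simp
  have h2 : inner ℝ x (u - c) ≤ ρ * δ :=
    (inner_le_norm_starProjection W x (W.sub_mem huW (hs c hc))).trans
      (mul_le_mul_of_nonneg_left hcu hρ0.le)
  rw [inner_sub_right, h1] at h2
  nlinarith

/-- Tail bound for the projection of the standardized residuals onto a subspace of small
dimension, with the sharp constant in the exponent. -/
theorem respProb_projection_le {n k : ℕ} (θ : Fin n → ℝ)
    (W : Submodule ℝ (EuclideanSpace ℝ (Fin n))) (hk : Module.finrank ℝ W ≤ k)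
    {δ τ η : ℝ} (hδ : 0 < δ) (hδ1 : δ ≤ 1) (hτ : 0 ≤ τ) (hη0 : 0 ≤ η)
    (hη : exp (τ * η) ≤ 1 + δ)
    (hW : ∀ w ∈ W, ‖w‖ ≤ 1 → ∀ i, |w i| ≤ η * √(varFun (θ i))) :
    respProb θ (fun y => τ < ‖W.starProjection (residual θ (resp y))‖)
      ≤ (1 + 2 / δ) ^ k * exp (-((1 - δ) ^ 3 * τ ^ 2 / 2)) := by
  obtain ⟨s, hs, hcard, hnet⟩ := exists_net_submodule W hδ
  have h1 := respProb_biUnion_le θ s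
    (fun c y => (1 - δ) * τ ≤ inner ℝ (residual θ (resp y)) c)
  have h2 : respProb θ (fun y => τ < ‖W.starProjection (residual θ (resp y))‖) ≤
      respProb θ (fun y => ∃ c ∈ s, (1 - δ) * τ ≤ inner ℝ (residual θ (resp y)) c) :=
    respProb_mono θ fun y hy => exists_net_point_of_lt_norm_starProjection W hτ s
      (fun c hc => (hs c hc).1) hnet hy hδ1
  have hv : ∀ i, 0 < √(varFun (θ i)) := fun i => sqrt_pos.2 (varFun_pos _)
  have h3 : ∀ c ∈ s, respProb θ (fun y => (1 - δ) * τ ≤ inner ℝ (residual θ (resp y)) c)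
      ≤ exp (-((1 - δ) ^ 3 * τ ^ 2 / 2)) := fun c hc => by
    simp only [inner_residual]
    -- The Chernoff parameter equals the threshold `(1 - δ) * τ`, the Gaussian optimum for variance
    -- 1. The mgf correction is at most `1 + δ`, which leaves the exponent `-(1 - δ)^2 τ^2 (1 - (1 +
    -- δ)/2) = -(1 - δ)^3 τ^2 / 2`.
    have ht : 0 ≤ (1 - δ) * τ := mul_nonneg (by linarith) hτ
    refine (respProb_chernoff θ (fun i => c i / √(varFun (θ i))) ht (η := η) (fun i => ?_)
      ?_).trans (exp_le_exp.2 ?_)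
    · rw [abs_div, abs_of_pos (hv i), div_le_iff₀ (hv i)]
      exact hW c (hs c hc).1 (hs c hc).2 i
    · have : ∑ i, (c i / √(varFun (θ i))) ^ 2 * varFun (θ i) = ‖c‖ ^ 2 := by
        rw [EuclideanSpace.norm_sq_eq]
        refine Finset.sum_congr rfl fun i _ => ?_
        rw [div_pow, sq_sqrt (varFun_pos _).le, div_mul_cancel₀ _ (varFun_pos _).ne', norm_eq_abs,
          sq_abs]
      rw [this]
      exact pow_le_one₀ (norm_nonneg _) (hs c hc).2
    · have he : exp ((1 - δ) * τ * η) ≤ 1 + δ := by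
        refine (exp_le_exp.2 ?_).trans hη
        rw [mul_assoc]
        exact mul_le_of_le_one_left (mul_nonneg hτ hη0) (by linarith)
      have : ((1 - δ) * τ) ^ 2 / 2 * exp ((1 - δ) * τ * η)
          ≤ ((1 - δ) * τ) ^ 2 / 2 * (1 + δ) := mul_le_mul_of_nonneg_left he (by positivity)
      refine (add_le_add le_rfl this).trans (le_of_eq ?_)
      ring
  calc _ ≤ _ := h2
    _ ≤ _ := h1
    _ ≤ ∑ c ∈ s, exp (-((1 - δ) ^ 3 * τ ^ 2 / 2)) := Finset.sum_le_sum h3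
    _ = s.card * exp (-((1 - δ) ^ 3 * τ ^ 2 / 2)) := by simp
    _ ≤ _ := by
      gcongr
      refine hcard.trans (pow_le_pow_right₀ ?_ hk)
      have : 0 ≤ 2 / δ := by positivity
      linarith

end Response

/-! ### Sparse vectors and the quadratic approximation of the log-likelihood -/

section Design

open Real
open scoped ENNReal

variable {n p : ℕ}

theorem mem_supp {u : EuclideanSpace ℝ (Fin p)} {j : Fin p} : j ∈ supp u ↔ u j ≠ 0 := by
  simp [supp]

/-- The subspace of vectors with support contained in `J`. -/
def suppSub (J : Finset (Fin p)) : Submodule ℝ (EuclideanSpace ℝ (Fin p)) where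
  carrier := {u | supp u ⊆ J}
  zero_mem' := by intro j; simp [supp]
  add_mem' := by
    intro u v hu hv j hj
    rw [mem_supp, PiLp.add_apply] at hj
    by_contra hjJ
    have h1 : u j = 0 := by
      by_contra h; exact hjJ (hu (by simpa [supp] using h))
    have h2 : v j = 0 := by
      by_contra h; exact hjJ (hv (by simpa [supp] using h))
    exact hj (by rw [h1, h2, add_zero])
  smul_mem' := by
    intro c u hu j hj
    rw [mem_supp, PiLp.smul_apply, smul_eq_mul] at hj
    exact hu (mem_supp.2 (right_ne_zero_of_mul hj))

theorem suppSub_mono {J K : Finset (Fin p)} (h : J ⊆ K) : suppSub J ≤ suppSub K :=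
  fun _ hu => Finset.Subset.trans hu h

theorem apply_eq_zero_of_mem_suppSub {J : Finset (Fin p)} {u : EuclideanSpace ℝ (Fin p)}
    (hu : u ∈ suppSub J) {j : Fin p} (hj : j ∉ J) : u j = 0 := by
  by_contra h
  exact hj (hu (by simpa [supp] using h))

theorem finrank_suppSub_le (J : Finset (Fin p)) : Module.finrank ℝ (suppSub J) ≤ J.card := by
  classical
  have h : suppSub J ≤ Submodule.span ℝ
      ((J.image fun j => EuclideanSpace.single j (1 : ℝ) : Finset _) : Set
        (EuclideanSpace ℝ (Fin p))) := by
    intro u hu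
    have e : u = ∑ j ∈ J, u j • EuclideanSpace.single j (1 : ℝ) := by
      ext k
      simp only [WithLp.ofLp_sum, WithLp.ofLp_smul, Finset.sum_apply, Pi.smul_apply,
        EuclideanSpace.single, smul_eq_mul]
      by_cases hk : k ∈ J
      · rw [Finset.sum_eq_single k]
        · simp
        · intro b _ hb; simp [hb.symm]
        · exact fun h => absurd hk h
      · rw [apply_eq_zero_of_mem_suppSub hu hk, Finset.sum_eq_zero]
        intro b hb
        have : k ≠ b := fun h => hk (h ▸ hb)
        simp [this]
    rw [e]
    exact Submodule.sum_mem _ fun j hj => Submodule.smul_mem _ _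
      (Submodule.subset_span (by simpa using ⟨j, hj, rfl⟩))
  exact (Submodule.finrank_mono h).trans
    ((finrank_span_finset_le_card _).trans Finset.card_image_le)

theorem exists_add_of_mem_suppSub_union [DecidableEq (Fin p)] {J K : Finset (Fin p)}
    {u : EuclideanSpace ℝ (Fin p)} (hu : u ∈ suppSub (J ∪ K)) :
    ∃ v ∈ suppSub J, ∃ w ∈ suppSub K, u = v + w := by
  refine ⟨WithLp.toLp 2 fun j => if j ∈ J then u j else 0, ?_,
    WithLp.toLp 2 fun j => if j ∈ J then 0 else u j, ?_, ?_⟩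
  · intro j hj
    by_contra h
    simp [supp, h] at hj
  · intro j hj
    by_contra h
    by_cases h' : j ∈ J
    · simp [supp, h'] at hj
    · have := apply_eq_zero_of_mem_suppSub hu (j := j) (by simp [h, h'])
      simp [supp, this] at hj
  · ext j
    by_cases h' : j ∈ J <;> simp [h']

/-- The derivative at `β₀` of the log-likelihood in the direction `u`. -/
def score (x : Fin n → EuclideanSpace ℝ (Fin p)) (y : Fin n → ℝ)
    (β₀ u : EuclideanSpace ℝ (Fin p)) : ℝ :=
  ∑ i, (y i - sigmoid (inner ℝ (x i) β₀)) * inner ℝ (x i) u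

/-- The quadratic form given by the negative Hessian at `β₀` of the log-likelihood. -/
def info (x : Fin n → EuclideanSpace ℝ (Fin p)) (β₀ u : EuclideanSpace ℝ (Fin p)) : ℝ :=
  ∑ i, varFun (inner ℝ (x i) β₀) * inner ℝ (x i) u ^ 2

/-- The weighted design map, an isometry from the metric given by `info` to `ℝ^n`. -/
def design (x : Fin n → EuclideanSpace ℝ (Fin p)) (β₀ : EuclideanSpace ℝ (Fin p)) :
    EuclideanSpace ℝ (Fin p) →ₗ[ℝ] EuclideanSpace ℝ (Fin n) where
  toFun u := WithLp.toLp 2 fun i => √(varFun (inner ℝ (x i) β₀)) * inner ℝ (x i) u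
  map_add' u v := by ext i; simp [inner_add_right, mul_add]
  map_smul' c u := by ext i; simp [inner_smul_right, mul_left_comm]

theorem design_apply (x : Fin n → EuclideanSpace ℝ (Fin p)) (β₀ u : EuclideanSpace ℝ (Fin p))
    (i : Fin n) : design x β₀ u i = √(varFun (inner ℝ (x i) β₀)) * inner ℝ (x i) u := rfl

theorem norm_design_sq (x : Fin n → EuclideanSpace ℝ (Fin p))
    (β₀ u : EuclideanSpace ℝ (Fin p)) : ‖design x β₀ u‖ ^ 2 = info x β₀ u := by
  rw [EuclideanSpace.norm_sq_eq]
  refine Finset.sum_congr rfl fun i _ => ?_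
  rw [design_apply, norm_eq_abs, sq_abs, mul_pow, sq_sqrt (varFun_pos _).le]

theorem inner_residual_design (x : Fin n → EuclideanSpace ℝ (Fin p)) (y : Fin n → ℝ)
    (β₀ u : EuclideanSpace ℝ (Fin p)) :
    inner ℝ (residual (fun i => inner ℝ (x i) β₀) y) (design x β₀ u) = score x y β₀ u := by
  rw [inner_residual]
  refine Finset.sum_congr rfl fun i _ => ?_
  have := (sqrt_pos.2 (varFun_pos (inner ℝ (x i) β₀))).ne'
  rw [design_apply, mul_div_cancel_left₀ _ this, mul_comm]

/-- Twice the increase over `β₀` of the quadratic approximation of the log-likelihood. -/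
def quadGain (x : Fin n → EuclideanSpace ℝ (Fin p)) (y : Fin n → ℝ)
    (β₀ u : EuclideanSpace ℝ (Fin p)) : ℝ :=
  2 * score x y β₀ u - info x β₀ u

/-- The maximum of `quadGain` over the vectors with support contained in `J`. -/
def maxGain (x : Fin n → EuclideanSpace ℝ (Fin p)) (y : Fin n → ℝ)
    (β₀ : EuclideanSpace ℝ (Fin p)) (J : Finset (Fin p)) : ℝ≥0∞ :=
  ⨆ u : suppSub J, ENNReal.ofReal (quadGain x y β₀ u)

theorem maxGain_empty (x : Fin n → EuclideanSpace ℝ (Fin p)) (y : Fin n → ℝ)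
    (β₀ : EuclideanSpace ℝ (Fin p)) : maxGain x y β₀ ∅ = 0 := by
  simp only [maxGain, ENNReal.iSup_eq_zero]
  rintro ⟨u, hu⟩
  have : u = 0 := by
    ext j; exact apply_eq_zero_of_mem_suppSub hu (by simp)
  subst this
  simp [quadGain, score, info]

/-- The conditions on the covariates under which the likelihood behaves well on vectors with
at most `m` non-zero entries. -/
structure GoodDesign (x : Fin n → EuclideanSpace ℝ (Fin p)) (β₀ : EuclideanSpace ℝ (Fin p))
    (m : ℕ) (c M a : ℝ) : Prop where
  info_ge : ∀ u : EuclideanSpace ℝ (Fin p), (supp u).card ≤ m → c * n * ‖u‖ ^ 2 ≤ info x β₀ u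
  cube_le : ∀ u : EuclideanSpace ℝ (Fin p), (supp u).card ≤ m →
    ∑ i, |inner ℝ (x i) u| ^ 3 ≤ M * n * ‖u‖ ^ 3
  bdd : ∀ i j, |x i j| ≤ a

/-- Only coordinates in the support contribute, and there the ℓ¹ norm is at most `√m` times the ℓ²
norm. -/
theorem abs_inner_le_of_bdd {z u : EuclideanSpace ℝ (Fin p)} {a : ℝ} {m : ℕ}
    (hz : ∀ j, |z j| ≤ a) (hu : (supp u).card ≤ m) (ha : 0 ≤ a) :
    |inner ℝ z u| ≤ a * √m * ‖u‖ := by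
  have h1 : inner ℝ z u = ∑ j ∈ supp u, z j * u j := by
    rw [PiLp.inner_apply]
    symm
    refine (Finset.sum_subset (Finset.subset_univ _) fun j _ hj => ?_).trans
      (Finset.sum_congr rfl fun j _ => by simp [mul_comm])
    have : u j = 0 := by simpa [supp] using hj
    simp [this]
  have h2 : ∑ j ∈ supp u, |u j| ≤ √m * ‖u‖ := by
    rw [← sqrt_sq (norm_nonneg u), ← sqrt_mul (by positivity)]
    refine le_sqrt_of_sq_le ?_
    refine sq_sum_le_card_mul_sum_sq.trans ?_
    refine mul_le_mul (by exact_mod_cast hu) ?_ (Finset.sum_nonneg fun _ _ => by positivity)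
      (by positivity)
    rw [EuclideanSpace.norm_sq_eq]
    simp only [norm_eq_abs]
    exact Finset.sum_le_sum_of_subset_of_nonneg (Finset.subset_univ _) fun _ _ _ => by positivity
  rw [h1]
  calc |∑ j ∈ supp u, z j * u j| ≤ ∑ j ∈ supp u, |z j * u j| := Finset.abs_sum_le_sum_abs _ _
    _ ≤ ∑ j ∈ supp u, a * |u j| := Finset.sum_le_sum fun j _ => by
        rw [abs_mul]; exact mul_le_mul_of_nonneg_right (hz j) (abs_nonneg _)
    _ = a * ∑ j ∈ supp u, |u j| := by rw [Finset.mul_sum]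
    _ ≤ a * (√m * ‖u‖) := mul_le_mul_of_nonneg_left h2 ha
    _ = _ := by ring

open scoped Classical in
/-- Tail bound for the increase of the maximum of the quadratic approximation when the variables
in `K` are added to those in `B`. -/
theorem respProb_maxGain_le {x : Fin n → EuclideanSpace ℝ (Fin p)}
    {β₀ : EuclideanSpace ℝ (Fin p)} {m : ℕ} {c M a : ℝ} (hx : GoodDesign x β₀ m c M a)
    (hn : 0 < n) (hc : 0 < c) (ha : 0 ≤ a) (B K : Finset (Fin p)) (hBK : (B ∪ K).card ≤ m)
    {δ τ : ℝ} (hδ : 0 < δ) (hδ1 : δ ≤ 1) (hτ : 0 ≤ τ)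
    (hη : exp (τ * (a * √m / √(c * n))) ≤ 1 + δ) :
    respProb (fun i => inner ℝ (x i) β₀) (fun y =>
        ¬ maxGain x (resp y) β₀ (B ∪ K) ≤ maxGain x (resp y) β₀ B + ENNReal.ofReal (τ ^ 2))
      ≤ (1 + 2 / δ) ^ K.card * exp (-((1 - δ) ^ 3 * τ ^ 2 / 2)) := by
  set T := design x β₀ with hT
  -- `V` is what the variables in `B` already explain. `W` collects the components orthogonal to `V`
  -- of the new columns, so its dimension is at most `K.card` whatever the size of `B`.
  set V := (suppSub B).map T with hV
  set L := (LinearMap.id - V.starProjection.toLinearMap) ∘ₗ T with hL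
  set W := (suppSub K).map L with hW
  have hWdim : Module.finrank ℝ W ≤ K.card :=
    (Submodule.finrank_map_le _ _).trans (finrank_suppSub_le K)
  have hcn : 0 < √(c * n) := sqrt_pos.2 (by positivity)
  have hLapp : ∀ u, L u = T u - V.starProjection (T u) := fun u => by simp [hL]
  have hWorth : ∀ w ∈ W, ∀ v ∈ V, inner ℝ v w = 0 := by
    rintro _ ⟨u, -, rfl⟩ v hv
    rw [hLapp]
    exact (Submodule.mem_orthogonal _ _).1 (V.sub_starProjection_mem_orthogonal (T u)) v hv
  have hWT : ∀ w ∈ W, ∃ u ∈ suppSub (B ∪ K), w = T u := by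
    rintro _ ⟨u, hu, rfl⟩
    obtain ⟨v, hv, hv'⟩ := V.starProjection_apply_mem (T u)
    refine ⟨u - v, Submodule.sub_mem _ (suppSub_mono Finset.subset_union_right hu)
      (suppSub_mono Finset.subset_union_left hv), ?_⟩
    rw [hLapp, map_sub, hv']
  refine (respProb_mono _ fun y hy => ?_).trans (respProb_projection_le _ W hWdim hδ hδ1 hτ
    (by positivity) hη ?_)
  · rw [not_le] at hy
    have hfin : maxGain x (resp y) β₀ B ≠ ⊤ := fun h => by
      rw [h, top_add] at hy; exact not_top_lt hy
    obtain ⟨⟨w, hw⟩, hlt⟩ := lt_iSup_iff.1 hy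
    set f := (maxGain x (resp y) β₀ B).toReal with hf
    have hBle : ∀ v ∈ suppSub B, quadGain x (resp y) β₀ v ≤ f := fun v hv => by
      have := le_iSup (fun u : suppSub B => ENNReal.ofReal (quadGain x (resp y) β₀ u)) ⟨v, hv⟩
      exact (ENNReal.ofReal_le_iff_le_toReal hfin).1 this
    have hlt' : f + τ ^ 2 < quadGain x (resp y) β₀ w := by
      rw [← ENNReal.ofReal_toReal hfin, ← ENNReal.ofReal_add ENNReal.toReal_nonneg (sq_nonneg _)]
        at hlt
      exact (ENNReal.ofReal_lt_ofReal_iff'.1 hlt).1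
    set ξ := residual (fun i => inner ℝ (x i) β₀) (resp y) with hξ
    have hq : ∀ u, quadGain x (resp y) β₀ u = 2 * inner ℝ ξ (T u) - ‖T u‖ ^ 2 := fun u => by
      rw [quadGain, ← inner_residual_design, norm_design_sq]
    obtain ⟨w0, hw0, wK, hwK, rfl⟩ := exists_add_of_mem_suppSub_union hw
    obtain ⟨v, hv, hv'⟩ := V.starProjection_apply_mem (T wK)
    set ω := L wK with hω
    have hωW : ω ∈ W := ⟨wK, hwK, rfl⟩
    have hdec : T (w0 + wK) = T (w0 + v) + ω := by
      rw [hω, hLapp, map_add, map_add, hv']; abel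
    have hvB : w0 + v ∈ suppSub B := Submodule.add_mem _ hw0 hv
    have horth : inner ℝ (T (w0 + v)) ω = 0 := hWorth ω hωW _ ⟨_, hvB, rfl⟩
    have h1 := hBle _ hvB
    rw [hq] at h1 hlt'
    rw [hdec, norm_add_sq_real, horth, inner_add_right] at hlt'
    have h2 := inner_le_norm_starProjection W ξ hωW
    set ρ := ‖W.starProjection ξ‖ with hρ
    -- The gain splits orthogonally into that of `w0 + v`, bounded by the maximum over `B`, and `2
    -- ⟨ξ, ω⟩ - ‖ω‖ ^ 2 ≤ 2 ρ ‖ω‖ - ‖ω‖ ^ 2 ≤ ρ ^ 2`.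
    have h3 : τ ^ 2 < ρ ^ 2 := by nlinarith [sq_nonneg (ρ - ‖ω‖)]
    exact lt_of_pow_lt_pow_left₀ 2 (norm_nonneg _) h3
  · intro w hw hw1 i
    obtain ⟨u, hu, rfl⟩ := hWT w hw
    have hcard : (supp u).card ≤ m := (Finset.card_le_card hu).trans hBK
    have h1 := hx.info_ge u hcard
    rw [← norm_design_sq] at h1
    -- The curvature bound forces the preimage `u` to be short, so bounded covariates keep every
    -- coordinate of `w` of order `√(m / n)`, as the Chernoff bound requires.
    have h2 : √(c * n) * ‖u‖ ≤ 1 := by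
      rw [← sqrt_sq (norm_nonneg u), ← sqrt_mul (by positivity), ← sqrt_one]
      exact sqrt_le_sqrt (h1.trans (pow_le_one₀ (norm_nonneg _) hw1))
    have h3 := abs_inner_le_of_bdd (hx.bdd i) hcard ha
    rw [hT, design_apply, abs_mul, abs_of_nonneg (sqrt_nonneg _), mul_comm]
    refine mul_le_mul_of_nonneg_right (h3.trans ?_) (sqrt_nonneg _)
    rw [le_div_iff₀ hcn]
    calc a * √m * ‖u‖ * √(c * n) = a * √m * (√(c * n) * ‖u‖) := by ring
      _ ≤ a * √m * 1 := by gcongr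
      _ = _ := mul_one _

end Design

/-! ### Union bound over the added sets of variables -/

section GoodResponse

open Real
open scoped ENNReal

variable {n p : ℕ}

open scoped Classical in
/-- The conditions on the responses under which the criterion selects `J₀`: each added variable
increases the maximum of the quadratic approximation of the log-likelihood by at most `s`. -/
structure GoodResponse (x : Fin n → EuclideanSpace ℝ (Fin p)) (y : Fin n → ℝ)
    (β₀ : EuclideanSpace ℝ (Fin p)) (J₀ : Finset (Fin p)) (q : ℕ) (s : ℝ) : Prop where
  base : maxGain x y β₀ J₀ ≤ ENNReal.ofReal (q * s)
  add : ∀ K : Finset (Fin p), K.card ≤ q →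
    maxGain x y β₀ (J₀ ∪ K) ≤ maxGain x y β₀ J₀ + ENNReal.ofReal (K.card * s)

/-- With `τ ^ 2 = k * s` a set of size `k` fails with probability at most `r ^ k`. Summed over all
nonempty sets this is at most `(1 + r) ^ p - 1 ≤ 2 * (p * r)`; the base event, the case of adding
`J₀` to the empty model, costs at most one more `p * r`. -/
theorem respProb_not_goodResponse_le {x : Fin n → EuclideanSpace ℝ (Fin p)}
    {β₀ : EuclideanSpace ℝ (Fin p)} {q : ℕ} {c M a : ℝ} (hx : GoodDesign x β₀ (2 * q) c M a)
    (hn : 0 < n) (hp : 0 < p) (hq : 1 ≤ q) (hc : 0 < c) (ha : 0 ≤ a) (J₀ : Finset (Fin p))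
    (hJ₀ : J₀.card ≤ q) {δ s : ℝ} (hδ : 0 < δ) (hδ1 : δ ≤ 1) (hs : 0 ≤ s)
    (hη : exp (√(q * s) * (a * √(2 * q : ℕ) / √(c * n))) ≤ 1 + δ)
    (hr : p * ((1 + 2 / δ) * exp (-((1 - δ) ^ 3 * s / 2))) ≤ 1) :
    respProb (fun i => inner ℝ (x i) β₀) (fun y => ¬ GoodResponse x (resp y) β₀ J₀ q s)
      ≤ 3 * (p * ((1 + 2 / δ) * exp (-((1 - δ) ^ 3 * s / 2)))) := by
  classical
  set C := 1 + 2 / δ with hC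
  set r := C * exp (-((1 - δ) ^ 3 * s / 2)) with hrdef
  have hC1 : 1 ≤ C := by
    have : 0 ≤ 2 / δ := by positivity
    linarith
  have hr0 : 0 ≤ r := by positivity
  have hp1 : (1 : ℝ) ≤ p := by exact_mod_cast hp
  have hrp : r ≤ p * r := le_mul_of_one_le_left hr0 hp1
  have hpow : ∀ k : ℕ, C ^ k * exp (-((1 - δ) ^ 3 * (√(k * s)) ^ 2 / 2)) = r ^ k := fun k => by
    rw [hrdef, mul_pow, sq_sqrt (by positivity), ← exp_nat_mul]
    congr 2
    ring
  have hmono : ∀ k : ℕ, k ≤ q →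
      exp (√(k * s) * (a * √(2 * q : ℕ) / √(c * n))) ≤ 1 + δ := fun k hk => by
    refine (exp_le_exp.2 ?_).trans hη
    gcongr
  have hbase : respProb (fun i => inner ℝ (x i) β₀)
      (fun y => ¬ maxGain x (resp y) β₀ J₀ ≤ ENNReal.ofReal (q * s)) ≤ p * r := by
    have h := respProb_maxGain_le hx hn hc ha ∅ J₀ (by simp; omega) hδ hδ1
      (sqrt_nonneg (q * s)) hη
    simp only [Finset.empty_union, maxGain_empty, zero_add] at h
    rw [sq_sqrt (by positivity)] at h
    refine h.trans ?_
    calc C ^ J₀.card * exp (-((1 - δ) ^ 3 * (q * s) / 2))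
        ≤ C ^ q * exp (-((1 - δ) ^ 3 * (q * s) / 2)) := by gcongr
      _ = r ^ q := by rw [← hpow q, sq_sqrt (by positivity)]
      _ ≤ r ^ 1 := pow_le_pow_of_le_one hr0 (hrp.trans hr) hq
      _ ≤ p * r := by rw [pow_one]; exact hrp
  -- The empty set is left out: its bound `r ^ 0 = 1` would be useless, while its inequality is
  -- trivial.
  set S : Finset (Finset (Fin p)) := Finset.univ.filter fun K => K.card ≤ q ∧ K ≠ ∅ with hS
  have hadd : respProb (fun i => inner ℝ (x i) β₀) (fun y => ∃ K ∈ S,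
      ¬ maxGain x (resp y) β₀ (J₀ ∪ K) ≤ maxGain x (resp y) β₀ J₀ + ENNReal.ofReal (K.card * s))
      ≤ 2 * (p * r) := by
    refine (respProb_biUnion_le _ S _).trans ?_
    calc _ ≤ ∑ K ∈ S, r ^ K.card := by
          refine Finset.sum_le_sum fun K hK => ?_
          have hKq := (Finset.mem_filter.1 hK).2.1
          have h := respProb_maxGain_le hx hn hc ha J₀ K
            ((Finset.card_union_le _ _).trans (by omega)) hδ hδ1
            (sqrt_nonneg (K.card * s)) (hmono _ hKq)
          rw [hpow, sq_sqrt (by positivity)] at h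
          exact h
      _ ≤ ∑ K ∈ Finset.univ.erase (∅ : Finset (Fin p)), r ^ K.card := by
          refine Finset.sum_le_sum_of_subset_of_nonneg ?_ fun _ _ _ => by positivity
          intro K hK
          simpa using (Finset.mem_filter.1 hK).2.2
      _ = (1 + r) ^ p - 1 := by
          rw [← sum_pow_card, ← Finset.add_sum_erase _ _ (Finset.mem_univ (∅ : Finset (Fin p)))]
          simp
      _ ≤ 2 * (p * r) := by linarith [one_add_pow_le hr0 hr]
  refine (respProb_mono _ fun y hy => ?_).trans ((respProb_or_le _ _ _).trans
    ((add_le_add hbase hadd).trans (le_of_eq (by ring))))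
  by_contra hcon
  rw [not_or, not_not] at hcon
  refine hy ⟨hcon.1, fun K hK => ?_⟩
  by_cases hKe : K = ∅
  · subst hKe; simp
  · by_contra h
    exact hcon.2 ⟨K, by simp [hS, hK, hKe], by convert h⟩

end GoodResponse

/-! ### From good designs and responses to model selection -/

section Likelihood

open Real
open scoped ENNReal

variable {n p : ℕ} {x : Fin n → EuclideanSpace ℝ (Fin p)} {y : Fin n → ℝ}
  {β₀ : EuclideanSpace ℝ (Fin p)}

theorem abs_logLik_sub_quadGain_le (x : Fin n → EuclideanSpace ℝ (Fin p)) (y : Fin n → ℝ)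
    (β₀ u : EuclideanSpace ℝ (Fin p)) :
    |2 * (logLik x y (β₀ + u) - logLik x y β₀) - quadGain x y β₀ u|
      ≤ 2 * ∑ i, |inner ℝ (x i) u| ^ 3 := by
  have e : 2 * (logLik x y (β₀ + u) - logLik x y β₀) - quadGain x y β₀ u
      = ∑ i, -2 * (cumulant (inner ℝ (x i) β₀ + inner ℝ (x i) u) - cumulant (inner ℝ (x i) β₀)
          - inner ℝ (x i) u * sigmoid (inner ℝ (x i) β₀)
          - inner ℝ (x i) u ^ 2 / 2 * varFun (inner ℝ (x i) β₀)) := by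
    simp only [logLik, quadGain, score, info, ← Finset.sum_sub_distrib, Finset.mul_sum,
      inner_add_right]
    exact Finset.sum_congr rfl fun i _ => by ring
  rw [e, Finset.mul_sum]
  refine (Finset.abs_sum_le_sum_abs _ _).trans (Finset.sum_le_sum fun i _ => ?_)
  rw [abs_mul, abs_neg, abs_two]
  exact mul_le_mul_of_nonneg_left (abs_cumulant_taylor_le _ _) (by norm_num)

theorem concaveOn_logLik (x : Fin n → EuclideanSpace ℝ (Fin p)) (y : Fin n → ℝ) :
    ConcaveOn ℝ Set.univ (logLik x y) := by
  unfold logLik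
  refine ⟨convex_univ, fun u _ v _ a b ha hb hab => ?_⟩
  simp only [smul_eq_mul, Finset.mul_sum, ← Finset.sum_add_distrib]
  refine Finset.sum_le_sum fun i _ => ?_
  have := convexOn_cumulant.2 (Set.mem_univ (inner ℝ (x i) u)) (Set.mem_univ (inner ℝ (x i) v))
    ha hb hab
  simp only [smul_eq_mul] at this
  simp only [inner_add_right, inner_smul_right]
  linarith

theorem continuous_logLik (x : Fin n → EuclideanSpace ℝ (Fin p)) (y : Fin n → ℝ) :
    Continuous (logLik x y) := by
  unfold logLik
  have := continuous_cumulant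
  fun_prop

theorem quadGain_le_of_maxGain_le {J : Finset (Fin p)} {F : ℝ}
    (h : maxGain x y β₀ J ≤ ENNReal.ofReal F) (hF : 0 ≤ F) {u : EuclideanSpace ℝ (Fin p)}
    (hu : u ∈ suppSub J) : quadGain x y β₀ u ≤ F := by
  have := (le_iSup (fun u : suppSub J => ENNReal.ofReal (quadGain x y β₀ u)) ⟨u, hu⟩).trans h
  exact (ENNReal.ofReal_le_ofReal_iff hF).1 this

/-- The bound at `u / 2` reads `score - info / 4 ≤ F`; doubling it leaves half of the curvature to
spare. -/
theorem quadGain_le_sub_info {J : Finset (Fin p)} {F : ℝ}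
    (h : ∀ u ∈ suppSub J, quadGain x y β₀ u ≤ F) {u : EuclideanSpace ℝ (Fin p)}
    (hu : u ∈ suppSub J) : quadGain x y β₀ u ≤ 2 * F - info x β₀ u / 2 := by
  have h1 := h ((1 / 2 : ℝ) • u) (Submodule.smul_mem _ _ hu)
  have e1 : score x y β₀ ((1 / 2 : ℝ) • u) = 1 / 2 * score x y β₀ u := by
    simp only [score, inner_smul_right, Finset.mul_sum]
    exact Finset.sum_congr rfl fun i _ => by ring
  have e2 : info x β₀ ((1 / 2 : ℝ) • u) = 1 / 4 * info x β₀ u := by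
    simp only [info, inner_smul_right, Finset.mul_sum]
    exact Finset.sum_congr rfl fun i _ => by ring
  rw [quadGain, e1, e2] at h1
  rw [quadGain]
  linarith

/-- On twice the log-likelihood difference, curvature contributes `-c/2`, the noise `2 * F` at most
`c/8`, and the cubic error at most `c/8` because `‖u‖ ≤ r₀ = c / (16 * M)`, all in units of `n * ‖u‖
^ 2`. -/
theorem logLik_sub_le_of_norm_le {m : ℕ} {c M a F r₀ : ℝ} (hx : GoodDesign x β₀ m c M a)
    {L : Finset (Fin p)} (hL : L.card ≤ m) (hF : ∀ u ∈ suppSub L, quadGain x y β₀ u ≤ F)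
    (hM : 0 < M) (hr₀ : r₀ = c / (16 * M)) {u : EuclideanSpace ℝ (Fin p)} (hu : u ∈ suppSub L)
    (hur : ‖u‖ ≤ r₀) (huF : F ≤ c / 16 * n * ‖u‖ ^ 2) :
    logLik x y (β₀ + u) - logLik x y β₀ ≤ -(c / 8 * n * ‖u‖ ^ 2) := by
  have hcard : (supp u).card ≤ m := (Finset.card_le_card hu).trans hL
  have h1 := (abs_le.1 (abs_logLik_sub_quadGain_le x y β₀ u)).2
  have h2 := quadGain_le_sub_info hF hu
  have h3 := hx.info_ge u hcard
  have h4 := hx.cube_le u hcard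
  have h5 : M * n * ‖u‖ ^ 3 ≤ c / 16 * n * ‖u‖ ^ 2 := by
    have : M * ‖u‖ ≤ c / 16 := by
      rw [hr₀, le_div_iff₀ (by positivity)] at hur
      linarith
    calc M * n * ‖u‖ ^ 3 = (M * ‖u‖) * (n * ‖u‖ ^ 2) := by ring
      _ ≤ c / 16 * (n * ‖u‖ ^ 2) := by gcongr
      _ = _ := by ring
  linarith

/-- Beyond radius `r₀` the Taylor bound is lost, but concavity along the ray propagates the loss on
the sphere linearly. -/
theorem logLik_sub_le {m : ℕ} {c M a F r₀ : ℝ} (hx : GoodDesign x β₀ m c M a)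
    {L : Finset (Fin p)} (hL : L.card ≤ m) (hF : ∀ u ∈ suppSub L, quadGain x y β₀ u ≤ F)
    (hM : 0 < M) (hc : 0 < c) (hr₀ : r₀ = c / (16 * M)) {u : EuclideanSpace ℝ (Fin p)}
    (hu : u ∈ suppSub L) (huF : F ≤ c / 16 * n * (min ‖u‖ r₀) ^ 2) :
    logLik x y (β₀ + u) - logLik x y β₀ ≤ -(c / 8 * n * (‖u‖ * min ‖u‖ r₀)) := by
  have hr₀pos : 0 < r₀ := by rw [hr₀]; positivity
  rcases le_total ‖u‖ r₀ with h | h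
  · rw [min_eq_left h] at huF ⊢
    have := logLik_sub_le_of_norm_le hx hL hF hM hr₀ hu h huF
    rwa [← sq]
  · rw [min_eq_right h] at huF ⊢
    have hupos : 0 < ‖u‖ := hr₀pos.trans_le h
    set t := r₀ / ‖u‖ with ht
    have ht0 : 0 < t := by positivity
    have ht1 : t ≤ 1 := (div_le_one hupos).2 h
    have hnorm : ‖t • u‖ = r₀ := by
      rw [norm_smul, norm_of_nonneg ht0.le, ht, div_mul_cancel₀ _ hupos.ne']
    have h1 := logLik_sub_le_of_norm_le hx hL hF hM hr₀ (Submodule.smul_mem _ t hu) hnorm.le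
      (by rwa [hnorm])
    have h2 := (concaveOn_logLik x y).2 (Set.mem_univ β₀) (Set.mem_univ (β₀ + u))
      (sub_nonneg.2 ht1) ht0.le (by ring)
    have e : (1 - t) • β₀ + t • (β₀ + u) = β₀ + t • u := by
      rw [smul_add, sub_smul, one_smul]; abel
    rw [e, smul_eq_mul, smul_eq_mul] at h2
    rw [hnorm] at h1
    have h3 : t * (logLik x y (β₀ + u) - logLik x y β₀) ≤ t * -(c / 8 * n * (‖u‖ * r₀)) := by
      have : t * ‖u‖ = r₀ := by rw [ht, div_mul_cancel₀ _ hupos.ne']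
      calc _ ≤ -(c / 8 * n * r₀ ^ 2) := by linarith
        _ = -(c / 8 * n * ((t * ‖u‖) * r₀)) := by rw [this]; ring
        _ = _ := by ring
    exact le_of_mul_le_mul_left h3 ht0

theorem isClosed_suppSub (J : Finset (Fin p)) :
    IsClosed (suppSub J : Set (EuclideanSpace ℝ (Fin p))) :=
  Submodule.closed_of_finiteDimensional _

open scoped Classical in
-- The loss away from `β₀` grows linearly, so outside a large ball the log-likelihood is below its
-- value at `0`. The ball contains `0`, hence the maximum over its compact intersection with the
-- model is global.
theorem exists_isMLE {m : ℕ} {c M a F r₀ : ℝ} (hx : GoodDesign x β₀ m c M a) (hn : 0 < n)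
    {J : Finset (Fin p)} (hL : (supp β₀ ∪ J).card ≤ m)
    (hF : ∀ u ∈ suppSub (supp β₀ ∪ J), quadGain x y β₀ u ≤ F)
    (hM : 0 < M) (hc : 0 < c) (hr₀ : r₀ = c / (16 * M)) (hFr : F ≤ c / 16 * n * r₀ ^ 2) :
    ∃ β, IsMLE x y J β := by
  have hr₀pos : 0 < r₀ := by rw [hr₀]; positivity
  have hn' : (0 : ℝ) < n := by exact_mod_cast hn
  have hκ : 0 < c / 8 * n * r₀ := by positivity
  set R := max (max r₀ ((logLik x y β₀ - logLik x y 0) / (c / 8 * n * r₀))) ‖β₀‖ with hR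
  have hcomp : IsCompact (Metric.closedBall β₀ R ∩ (suppSub J : Set (EuclideanSpace ℝ (Fin p)))) :=
    (isCompact_closedBall β₀ R).inter_right (isClosed_suppSub J)
  have h0 : (0 : EuclideanSpace ℝ (Fin p)) ∈ Metric.closedBall β₀ R ∩
      (suppSub J : Set (EuclideanSpace ℝ (Fin p))) :=
    ⟨by simp [hR], Submodule.zero_mem _⟩
  obtain ⟨β, hβ, hmax⟩ := hcomp.exists_isMaxOn ⟨0, h0⟩ (continuous_logLik x y).continuousOn
  refine ⟨β, hβ.2, fun β' hβ' => ?_⟩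
  by_cases hin : β' ∈ Metric.closedBall β₀ R
  · exact hmax ⟨hin, hβ'⟩
  · rw [Metric.mem_closedBall, dist_eq_norm, not_le] at hin
    have hu : β' - β₀ ∈ suppSub (supp β₀ ∪ J) :=
      Submodule.sub_mem _ (suppSub_mono Finset.subset_union_right hβ')
        (suppSub_mono Finset.subset_union_left (Finset.Subset.refl _))
    have h1 : r₀ ≤ ‖β' - β₀‖ := ((le_max_left _ _).trans (le_max_left _ _)).trans hin.le
    have h2 := logLik_sub_le hx hL hF hM hc hr₀ hu (by rwa [min_eq_right h1])
    rw [min_eq_right h1, add_sub_cancel] at h2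
    have h3 : (logLik x y β₀ - logLik x y 0) / (c / 8 * n * r₀) ≤ ‖β' - β₀‖ :=
      ((le_max_right _ _).trans (le_max_left _ _)).trans hin.le
    rw [div_le_iff₀ hκ] at h3
    have h4 := hmax h0
    simp only [Set.mem_ofPred_eq] at h4
    linarith

/-- A near-maximizer suffices, which avoids proving that the supremum is attained. Its gain is kept
nonnegative because that is what later bounds its norm. -/
theorem exists_quadGain_near_maxGain {J : Finset (Fin p)} (hfin : maxGain x y β₀ J ≠ ⊤) {η : ℝ}
    (hη : 0 < η) : ∃ v ∈ suppSub J, 0 ≤ quadGain x y β₀ v ∧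
      (maxGain x y β₀ J).toReal ≤ quadGain x y β₀ v + η := by
  rcases le_or_gt (maxGain x y β₀ J).toReal η with h | h
  · exact ⟨0, Submodule.zero_mem _, by simp [quadGain, score, info],
      by simpa [quadGain, score, info] using h⟩
  · have hlt : ENNReal.ofReal ((maxGain x y β₀ J).toReal - η) < maxGain x y β₀ J := by
      rw [ENNReal.ofReal_lt_iff_lt_toReal (by linarith) hfin]
      linarith
    obtain ⟨⟨v, hv⟩, hlt'⟩ := lt_iSup_iff.1 hlt
    have := (ENNReal.ofReal_lt_ofReal_iff'.1 hlt').1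
    exact ⟨v, hv, by linarith, by linarith⟩

/-- On good designs and good responses the extended BIC selects the support of `β₀`. -/
theorem ebicSelects_of_good {q : ℕ} {c M a s γ r₀ r₁ : ℝ}
    (hx : GoodDesign x β₀ (2 * q) c M a) (hn : 0 < n) (hq : 1 ≤ q)
    (hβ₀ : (supp β₀).card ≤ q) (hy : GoodResponse x y β₀ (supp β₀) q s)
    (hM : 0 < M) (hc : 0 < c) (hs : 0 < s) (hr₀ : r₀ = c / (16 * M))
    (hr₁ : r₁ ^ 2 = 32 * q * s / (c * n)) (hr₁0 : 0 ≤ r₁) (hr₁r₀ : r₁ ≤ r₀)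
    (hsuper : s + 4 * M * n * r₁ ^ 3 < log n + 2 * γ * log p)
    (hβmin : ∀ j ∈ supp β₀, r₁ ≤ |β₀ j|)
    (hsub : ∀ j ∈ supp β₀, q * (log n + 2 * γ * log p)
      < c / 4 * n * (|β₀ j| * min |β₀ j| r₀)) :
    EBICSelects γ q x y (supp β₀) := by
  classical
  have hn' : (0 : ℝ) < n := by exact_mod_cast hn
  have hq' : (1 : ℝ) ≤ q := by exact_mod_cast hq
  have hr₀pos : 0 < r₀ := by rw [hr₀]; positivity
  set lam := log n + 2 * γ * log p with hlam
  have hlam0 : 0 < lam := lt_of_le_of_lt (by positivity) hsuper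
  -- `r₁` is the radius from which curvature beats the noise level `2 * (q * s)`: `q * s` for the
  -- base and at most `q * s` for the added variables.
  have hr₁F : 2 * (q * s) = c / 16 * n * r₁ ^ 2 := by rw [hr₁]; field_simp; ring
  have hcard : ∀ J : Finset (Fin p), J.card ≤ q → (supp β₀ ∪ J).card ≤ 2 * q := fun J hJ =>
    (Finset.card_union_le _ _).trans (by omega)
  have hFmax : ∀ J : Finset (Fin p), J.card ≤ q →
      maxGain x y β₀ (supp β₀ ∪ J) ≤ ENNReal.ofReal (2 * (q * s)) := fun J hJ => by
    have h1 := (hy.add J hJ).trans (add_le_add_left hy.base _)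
    rw [← ENNReal.ofReal_add (by positivity) (by positivity)] at h1
    have h2 : (J.card : ℝ) * s ≤ q * s := by gcongr
    refine (by convert h1 : maxGain x y β₀ (supp β₀ ∪ J) ≤ _).trans
      (ENNReal.ofReal_le_ofReal (by linarith))
  have hF : ∀ J : Finset (Fin p), J.card ≤ q → ∀ u ∈ suppSub (supp β₀ ∪ J),
      quadGain x y β₀ u ≤ 2 * (q * s) := fun J hJ u hu =>
    quadGain_le_of_maxGain_le (hFmax J hJ) (by positivity) hu
  have hFr : 2 * (q * s) ≤ c / 16 * n * r₀ ^ 2 := by rw [hr₁F]; gcongr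
  have hex : ∀ J : Finset (Fin p), ∃ β, J.card ≤ q → IsMLE x y J β := fun J => by
    by_cases hJ : J.card ≤ q
    · obtain ⟨β, hβ⟩ := exists_isMLE hx hn (hcard J hJ) (hF J hJ) hM hc hr₀ hFr
      exact ⟨β, fun _ => hβ⟩
    · exact ⟨0, fun h => absurd h hJ⟩
  choose βhat hβhat using hex
  have hdiff : ∀ J : Finset (Fin p), J.card ≤ q → βhat J - β₀ ∈ suppSub (supp β₀ ∪ J) :=
    fun J hJ => Submodule.sub_mem _ (suppSub_mono Finset.subset_union_right (hβhat J hJ).1)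
        (suppSub_mono Finset.subset_union_left (Finset.Subset.refl _))
  have hloss : ∀ J : Finset (Fin p), J.card ≤ q → r₁ ≤ ‖βhat J - β₀‖ →
      logLik x y (βhat J) - logLik x y β₀
        ≤ -(c / 8 * n * (‖βhat J - β₀‖ * min ‖βhat J - β₀‖ r₀)) := fun J hJ h => by
    have := logLik_sub_le hx (hcard J hJ) (hF J hJ) hM hc hr₀ (hdiff J hJ)
      (by rw [hr₁F]; have := le_min h hr₁r₀; gcongr)
    rwa [add_sub_cancel] at this
  have hr₁pos : 0 < r₁ := by
    have : 0 < r₁ ^ 2 := by rw [hr₁]; positivity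
    exact lt_of_le_of_ne hr₁0 fun h => by rw [← h] at this; simp at this
  have key : ∀ J : Finset (Fin p), J.card ≤ q → J ≠ supp β₀ →
      ebic γ x y (supp β₀) (βhat (supp β₀)) < ebic γ x y J (βhat J) := by
    intro J hJ hne
    have hML0 := (hβhat (supp β₀) hβ₀).2
    have hℓ0 : logLik x y β₀ ≤ logLik x y (βhat (supp β₀)) := hML0 β₀ (Finset.Subset.refl _)
    unfold ebic
    rw [← hlam]
    -- If `J` contains the true support, the penalty decides; otherwise the lost likelihood does.
    by_cases hsubset : supp β₀ ⊆ J
    · have hℓJ : logLik x y β₀ ≤ logLik x y (βhat J) := (hβhat J hJ).2 β₀ hsubset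
      have hnormJ : ‖βhat J - β₀‖ < r₁ := by
        by_contra! h
        have h1 := hloss J hJ h
        have : 0 < c / 8 * n * (‖βhat J - β₀‖ * min ‖βhat J - β₀‖ r₀) := by
          have h2 : 0 < ‖βhat J - β₀‖ := hr₁pos.trans_le h
          have h3 : 0 < min ‖βhat J - β₀‖ r₀ := lt_min h2 hr₀pos
          positivity
        linarith
      have hunion : supp β₀ ∪ (J \ supp β₀) = J := Finset.union_sdiff_of_subset hsubset
      have hKcard : (J \ supp β₀).card + (supp β₀).card = J.card :=
        Finset.card_sdiff_add_card_eq_card hsubset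
      set k := (J \ supp β₀).card with hk
      have hk1 : 1 ≤ k := by
        rw [hk, Nat.one_le_iff_ne_zero, Ne, Finset.card_eq_zero, Finset.sdiff_eq_empty_iff_subset]
        exact fun h => hne (Finset.Subset.antisymm h hsubset)
      have hfin : maxGain x y β₀ (supp β₀) ≠ ⊤ := ne_top_of_le_ne_top ENNReal.ofReal_ne_top hy.base
      set g := (maxGain x y β₀ (supp β₀)).toReal with hg
      have hgain : quadGain x y β₀ (βhat J - β₀) ≤ g + k * s := by
        have h1 := hy.add (J \ supp β₀) (by omega)
        have h2 : maxGain x y β₀ J ≤ ENNReal.ofReal (g + k * s) := by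
          rw [ENNReal.ofReal_add ENNReal.toReal_nonneg (by positivity),
            ENNReal.ofReal_toReal hfin]
          calc maxGain x y β₀ J = maxGain x y β₀ (supp β₀ ∪ (J \ supp β₀)) := by rw [hunion]
            _ ≤ _ := by convert h1
        refine quadGain_le_of_maxGain_le h2 (add_nonneg ENNReal.toReal_nonneg (by positivity)) ?_
        have := hdiff J hJ
        rwa [Finset.union_eq_right.2 hsubset] at this
      have hup : 2 * (logLik x y (βhat J) - logLik x y β₀)
          ≤ g + k * s + 2 * (M * n * r₁ ^ 3) := by
        have h1 := (abs_le.1 (abs_logLik_sub_quadGain_le x y β₀ (βhat J - β₀))).2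
        rw [add_sub_cancel] at h1
        have h2 := hx.cube_le (βhat J - β₀)
          ((Finset.card_le_card (hdiff J hJ)).trans (hcard J hJ))
        have h3 : M * n * ‖βhat J - β₀‖ ^ 3 ≤ M * n * r₁ ^ 3 := by gcongr
        linarith
      -- Half of the slack between penalty and gain is spent on the near-maximizer.
      set η := (lam - (s + 4 * M * n * r₁ ^ 3)) / 2 with hη
      have hη0 : 0 < η := by rw [hη]; linarith
      obtain ⟨v, hv, hv0, hvg⟩ := exists_quadGain_near_maxGain hfin hη0
      have hvcard : (supp v).card ≤ 2 * q := (Finset.card_le_card hv).trans (by omega)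
      have hvr : ‖v‖ ≤ r₁ := by
        have h1 := quadGain_le_sub_info (hF (supp β₀) hβ₀) (u := v) (by
          rw [Finset.union_self]; exact hv)
        have h2 := hx.info_ge v hvcard
        have h3 : c * n * ‖v‖ ^ 2 ≤ c * n * r₁ ^ 2 := by
          have : 0 ≤ c * n * r₁ ^ 2 := by positivity
          linarith
        exact le_of_sq_le_sq (le_of_mul_le_mul_left h3 (by positivity)) hr₁0
      -- The estimator on the true support recovers the base gain `g` up to `η` and a cubic error,
      -- so `g` cancels against `hup` and only the increment `k * s` has to be paid for.
      have hlow : g - η - 2 * (M * n * r₁ ^ 3)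
          ≤ 2 * (logLik x y (βhat (supp β₀)) - logLik x y β₀) := by
        have h1 := (abs_le.1 (abs_logLik_sub_quadGain_le x y β₀ v)).1
        have h2 := hx.cube_le v hvcard
        have h3 : M * n * ‖v‖ ^ 3 ≤ M * n * r₁ ^ 3 := by gcongr
        have h4 := hML0 (β₀ + v)
          (Submodule.add_mem (suppSub (supp β₀)) (Finset.Subset.refl _) hv)
        linarith
      have hk1' : (1 : ℝ) ≤ k := by exact_mod_cast hk1
      have hJk : (J.card : ℝ) = k + (supp β₀).card := by exact_mod_cast hKcard.symm
      -- The errors occur once but the slack occurs `k ≥ 1` times.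
      have hkr : 4 * M * n * r₁ ^ 3 + η ≤ k * (4 * M * n * r₁ ^ 3 + η) :=
        le_mul_of_one_le_left (by positivity) hk1'
      have hfinal : k * s + (4 * M * n * r₁ ^ 3 + η) < k * lam := by
        calc k * s + (4 * M * n * r₁ ^ 3 + η) ≤ k * (s + (4 * M * n * r₁ ^ 3 + η)) := by linarith
          _ < k * lam := by
            refine mul_lt_mul_of_pos_left ?_ (by linarith)
            rw [hη]; linarith
      rw [hJk, add_mul]
      linarith
    · obtain ⟨j, hj, hjJ⟩ := Finset.not_subset.1 hsubset
      have hbj : |β₀ j| ≤ ‖βhat J - β₀‖ := by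
        have h1 := PiLp.norm_apply_le (βhat J - β₀) j
        rw [PiLp.sub_apply, apply_eq_zero_of_mem_suppSub (hβhat J hJ).1 hjJ, zero_sub, norm_neg,
          norm_eq_abs] at h1
        exact h1
      have h1 := hloss J hJ ((hβmin j hj).trans hbj)
      have h2 : |β₀ j| * min |β₀ j| r₀ ≤ ‖βhat J - β₀‖ * min ‖βhat J - β₀‖ r₀ :=
        mul_le_mul hbj (min_le_min_right _ hbj) (le_min (abs_nonneg _) hr₀pos.le) (norm_nonneg _)
      have h3 : c / 8 * n * (|β₀ j| * min |β₀ j| r₀)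
          ≤ c / 8 * n * (‖βhat J - β₀‖ * min ‖βhat J - β₀‖ r₀) := by gcongr
      have h4 := hsub j hj
      have h5 : ((supp β₀).card : ℝ) * lam ≤ q * lam := by gcongr
      have h6 : 0 ≤ (J.card : ℝ) * lam := by positivity
      linarith
  refine ⟨βhat, hβhat, Set.eq_singleton_iff_unique_mem.2 ⟨⟨hβ₀, fun J hJ => ?_⟩, ?_⟩⟩
  · rcases eq_or_ne J (supp β₀) with rfl | h
    · exact le_rfl
    · exact (key J hJ h).le
  · rintro J ⟨hJ, hJmin⟩
    by_contra h
    exact absurd (hJmin (supp β₀) hβ₀) (not_le.2 (key J hJ h))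

end Likelihood

/-! ### Measurability, and conditioning on the covariates -/

section Sampling

open Real
open scoped ENNReal

variable {n p : ℕ}

/-- A supremum of continuous functions with values in `[0, ∞]` is lower semicontinuous, even over an
uncountable family. Truncation at `0` is harmless since the zero vector has zero gain. -/
theorem measurable_maxGain (y : Fin n → ℝ) (β₀ : EuclideanSpace ℝ (Fin p))
    (J : Finset (Fin p)) :
    Measurable (fun x : Fin n → EuclideanSpace ℝ (Fin p) => maxGain x y β₀ J) := by
  unfold maxGain
  refine LowerSemicontinuous.measurable (lowerSemicontinuous_iSup fun u => ?_)
  refine Continuous.lowerSemicontinuous (ENNReal.continuous_ofReal.comp ?_)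
  unfold quadGain score info
  have h1 := continuous_sigmoid
  have h2 := continuous_varFun
  fun_prop

theorem measurableSet_goodResponse (y : Fin n → ℝ) (β₀ : EuclideanSpace ℝ (Fin p))
    (J₀ : Finset (Fin p)) (q : ℕ) (s : ℝ) :
    MeasurableSet {x : Fin n → EuclideanSpace ℝ (Fin p) | GoodResponse x y β₀ J₀ q s} := by
  classical
  have e : {x : Fin n → EuclideanSpace ℝ (Fin p) | GoodResponse x y β₀ J₀ q s}
      = {x | maxGain x y β₀ J₀ ≤ ENNReal.ofReal (q * s)} ∩
        ⋂ K : Finset (Fin p), ⋂ _ : K.card ≤ q,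
          {x | maxGain x y β₀ (J₀ ∪ K) ≤ maxGain x y β₀ J₀ + ENNReal.ofReal (K.card * s)} := by
    ext x
    simp only [Set.mem_ofPred_eq, Set.mem_inter_iff, Set.mem_iInter]
    exact ⟨fun h => ⟨h.base, fun K hK => by convert h.add K hK⟩,
      fun h => ⟨h.1, fun K hK => by convert h.2 K hK⟩⟩
  rw [e]
  refine (measurableSet_le (measurable_maxGain _ _ _) measurable_const).inter ?_
  exact MeasurableSet.iInter fun K => MeasurableSet.iInter fun _ =>
    measurableSet_le (measurable_maxGain _ _ _) ((measurable_maxGain _ _ _).add_const _)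

/-- The intersection over sparse vectors is uncountable, but every condition is closed. -/
theorem measurableSet_goodDesign (β₀ : EuclideanSpace ℝ (Fin p)) (m : ℕ) (c M a : ℝ) :
    MeasurableSet {x : Fin n → EuclideanSpace ℝ (Fin p) | GoodDesign x β₀ m c M a} := by
  have e : {x : Fin n → EuclideanSpace ℝ (Fin p) | GoodDesign x β₀ m c M a}
      = (⋂ u : EuclideanSpace ℝ (Fin p), ⋂ _ : (supp u).card ≤ m,
          {x | c * n * ‖u‖ ^ 2 ≤ info x β₀ u}) ∩
        ((⋂ u : EuclideanSpace ℝ (Fin p), ⋂ _ : (supp u).card ≤ m,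
          {x | ∑ i, |inner ℝ (x i) u| ^ 3 ≤ M * n * ‖u‖ ^ 3}) ∩
        ⋂ i, ⋂ j, {x | |x i j| ≤ a}) := by
    ext x
    simp only [Set.mem_ofPred_eq, Set.mem_inter_iff, Set.mem_iInter]
    exact ⟨fun h => ⟨h.1, h.2, h.3⟩, fun h => ⟨h.1, h.2.1, h.2.2⟩⟩
  rw [e]
  have h2 := continuous_varFun
  refine IsClosed.measurableSet (IsClosed.inter ?_ (IsClosed.inter ?_ ?_))
  · refine isClosed_iInter fun u => isClosed_iInter fun _ => isClosed_le continuous_const ?_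
    unfold info
    fun_prop
  · refine isClosed_iInter fun u => isClosed_iInter fun _ => isClosed_le ?_ continuous_const
    fun_prop
  · refine isClosed_iInter fun i => isClosed_iInter fun j => isClosed_le ?_ continuous_const
    fun_prop

variable {Ω : Type*} [MeasurableSpace Ω] {μ : Measure Ω}
  {X : Fin n → Ω → EuclideanSpace ℝ (Fin p)} {Y : Fin n → Ω → ℝ} {β₀ : EuclideanSpace ℝ (Fin p)}

theorem IsLogisticSample.condExp_eq (h : IsLogisticSample μ X Y β₀) (i : Fin n) :
    (μ⟦Y i ⁻¹' {1} | MeasurableSpace.comap (X i) inferInstance⟧)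
      =ᵐ[μ] fun ω => sigmoid (inner ℝ (X i ω) β₀) := by
  filter_upwards [h.logit i] with ω hω
  obtain ⟨h0, h1, h2⟩ := hω
  set r := (μ⟦Y i ⁻¹' {1} | MeasurableSpace.comap (X i) inferInstance⟧) ω
  rw [← h2, sigmoid_eq, exp_log (div_pos h0 (by linarith))]
  have : 1 - r ≠ 0 := by linarith
  field_simp
  ring

variable [IsProbabilityMeasure μ]

/-- The response `1` is the defining property of conditional expectation; the response `0` follows
by subtracting from the total, which needs finite measure. -/
theorem IsLogisticSample.measure_inter (h : IsLogisticSample μ X Y β₀) (i : Fin n) (b : Bool)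
    {B : Set (EuclideanSpace ℝ (Fin p))} (hB : MeasurableSet B) :
    μ (X i ⁻¹' B ∩ Y i ⁻¹' {if b then 1 else 0}) = ∫⁻ ω in X i ⁻¹' B,
      ENNReal.ofReal (if b then sigmoid (inner ℝ (X i ω) β₀)
        else 1 - sigmoid (inner ℝ (X i ω) β₀)) ∂μ := by
  have hm : MeasurableSpace.comap (X i) inferInstance ≤ (inferInstance : MeasurableSpace Ω) :=
    (h.measurable_X i).comap_le
  have hXB : MeasurableSet (X i ⁻¹' B) := h.measurable_X i hB
  have hY : MeasurableSet (Y i ⁻¹' {1}) := h.measurable_Y i (measurableSet_singleton 1)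
  have hσ : Measurable fun ω => sigmoid (inner ℝ (X i ω) β₀) :=
    continuous_sigmoid.measurable.comp ((h.measurable_X i).inner_const)
  have hσi : Integrable (fun ω => sigmoid (inner ℝ (X i ω) β₀)) μ :=
    Integrable.of_bound hσ.aestronglyMeasurable 1 (ae_of_all _ fun ω => by
      rw [norm_eq_abs, abs_of_nonneg (sigmoid_nonneg _)]; exact sigmoid_le_one _)
  have h1 : μ.real (X i ⁻¹' B ∩ Y i ⁻¹' {1})
      = ∫ ω in X i ⁻¹' B, sigmoid (inner ℝ (X i ω) β₀) ∂μ := by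
    have hint : Integrable ((Y i ⁻¹' {1}).indicator fun _ => (1 : ℝ)) μ :=
      (integrable_const _).indicator hY
    have e1 := setIntegral_condExp hm hint (s := X i ⁻¹' B) ⟨B, hB, rfl⟩
    rw [integral_indicator hY, Measure.restrict_restrict hY] at e1
    simp only [integral_const, smul_eq_mul, mul_one, measureReal_restrict_apply_univ] at e1
    rw [Set.inter_comm, ← e1]
    exact setIntegral_congr_ae hXB ((h.condExp_eq i).mono fun ω hω _ => hω)
  have htrue : μ (X i ⁻¹' B ∩ Y i ⁻¹' {1})
      = ∫⁻ ω in X i ⁻¹' B, ENNReal.ofReal (sigmoid (inner ℝ (X i ω) β₀)) ∂μ := by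
    rw [← ofReal_integral_eq_lintegral_ofReal hσi.integrableOn
      (ae_of_all _ fun ω => sigmoid_nonneg _), ← h1, ofReal_measureReal]
  cases b with
  | true => simpa using htrue
  | false =>
    simp only [Bool.false_eq_true, if_false]
    have hsplit : μ (X i ⁻¹' B ∩ Y i ⁻¹' {1}) + μ (X i ⁻¹' B ∩ Y i ⁻¹' {0}) = μ (X i ⁻¹' B) := by
      rw [← measure_inter_add_sdiff (X i ⁻¹' B) hY]
      congr 2
      ext ω
      simp only [Set.mem_inter_iff, Set.mem_preimage, Set.mem_singleton_iff, Set.mem_sdiff]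
      rcases h.binary i ω with h' | h' <;> simp [h']
    have hsum : (∫⁻ ω in X i ⁻¹' B, ENNReal.ofReal (sigmoid (inner ℝ (X i ω) β₀)) ∂μ)
        + ∫⁻ ω in X i ⁻¹' B, ENNReal.ofReal (1 - sigmoid (inner ℝ (X i ω) β₀)) ∂μ
        = μ (X i ⁻¹' B) := by
      rw [← lintegral_add_left hσ.ennreal_ofReal]
      have : ∀ ω, ENNReal.ofReal (sigmoid (inner ℝ (X i ω) β₀))
          + ENNReal.ofReal (1 - sigmoid (inner ℝ (X i ω) β₀)) = 1 := fun ω => by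
        rw [← ENNReal.ofReal_add (sigmoid_nonneg _) (sub_nonneg.2 (sigmoid_le_one _))]
        simp
      simp [this]
    rw [← hsum, htrue] at hsplit
    refine (ENNReal.add_right_inj ?_).1 hsplit
    rw [← htrue]
    exact measure_ne_top _ _

/-- Given the covariates, the responses are independent Bernoulli variables. -/
theorem IsLogisticSample.measure_eq_lintegral (h : IsLogisticSample μ X Y β₀) (y : Fin n → Bool)
    {G : Set (Fin n → EuclideanSpace ℝ (Fin p))} (hG : MeasurableSet G) :
    μ {ω | (fun i => X i ω) ∈ G ∧ ∀ i, Y i ω = resp y i}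
      = ∫⁻ ω in {ω | (fun i => X i ω) ∈ G}, ∏ i, ENNReal.ofReal
        (if y i then sigmoid (inner ℝ (X i ω) β₀) else 1 - sigmoid (inner ℝ (X i ω) β₀)) ∂μ := by
  set w : Fin n → EuclideanSpace ℝ (Fin p) → ℝ≥0∞ := fun i z => ENNReal.ofReal
    (if y i then sigmoid (inner ℝ z β₀) else 1 - sigmoid (inner ℝ z β₀)) with hw
  have hwm : ∀ i, Measurable (w i) := fun i => by
    have h1 := continuous_sigmoid
    refine (Continuous.measurable ?_).ennreal_ofReal
    split_ifs <;> fun_prop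
  set V : Ω → Fin n → EuclideanSpace ℝ (Fin p) := fun ω i => X i ω with hVdef
  have hV : Measurable V := measurable_pi_lambda _ fun i => h.measurable_X i
  have hYi : ∀ i, MeasurableSet (Y i ⁻¹' {resp y i}) := fun i =>
    h.measurable_Y i (measurableSet_singleton _)
  have hYm : MeasurableSet {ω | ∀ i, Y i ω = resp y i} := by
    have : {ω | ∀ i, Y i ω = resp y i} = ⋂ i, Y i ⁻¹' {resp y i} := by ext; simp
    rw [this]
    exact MeasurableSet.iInter hYi
  have hmX : ∀ i (B : Set (EuclideanSpace ℝ (Fin p))), MeasurableSet B →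
      (μ.restrict (Y i ⁻¹' {resp y i})).map (X i) B
        = ∫⁻ ω, (B.indicator (w i)) (X i ω) ∂μ := fun i B hB => by
    rw [Measure.map_apply (h.measurable_X i) hB, Measure.restrict_apply (h.measurable_X i hB)]
    have := h.measure_inter i (y i) hB
    rw [← lintegral_indicator (h.measurable_X i hB)] at this
    exact this
  -- The law of the covariates restricted to `Y = y`, and their law under the density given by the
  -- Bernoulli weights, both equal the same product measure; independence gives each on rectangles.
  have e1 : Measure.pi (fun i => (μ.restrict (Y i ⁻¹' {resp y i})).map (X i))
      = (μ.restrict {ω | ∀ i, Y i ω = resp y i}).map V := by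
    refine Measure.pi_eq fun s hs => ?_
    rw [Measure.map_apply hV (MeasurableSet.univ_pi hs),
      Measure.restrict_apply (hV (MeasurableSet.univ_pi hs))]
    have h1 := h.indep.measure_inter_preimage_eq_mul Finset.univ
      (sets := fun i => s i ×ˢ {resp y i})
      (fun i _ => (hs i).prod (measurableSet_singleton _))
    calc _ = μ (⋂ i ∈ Finset.univ, (fun ω => (X i ω, Y i ω)) ⁻¹' (s i ×ˢ {resp y i})) := by
          congr 1
          ext ω
          simp only [hVdef, Set.mem_inter_iff, Set.mem_preimage, Set.mem_pi, Set.mem_univ,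
            forall_const, Set.mem_ofPred_eq, Finset.mem_univ, Set.iInter_true, Set.mem_iInter,
            Set.mem_prod, Set.mem_singleton_iff]
          exact forall_and.symm
      _ = _ := h1
      _ = _ := Finset.prod_congr rfl fun i _ => by
          rw [Measure.map_apply (h.measurable_X i) (hs i),
            Measure.restrict_apply (h.measurable_X i (hs i))]
          rfl
  have hdm : Measurable fun ω => ∏ i, w i (X i ω) :=
    Finset.measurable_prod _ fun i _ => (hwm i).comp (h.measurable_X i)
  have e2 : Measure.pi (fun i => (μ.restrict (Y i ⁻¹' {resp y i})).map (X i))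
      = (μ.withDensity fun ω => ∏ i, w i (X i ω)).map V := by
    refine Measure.pi_eq fun s hs => ?_
    rw [Measure.map_apply hV (MeasurableSet.univ_pi hs),
      withDensity_apply _ (hV (MeasurableSet.univ_pi hs)),
      ← lintegral_indicator (hV (MeasurableSet.univ_pi hs))]
    simp only [hmX _ _ (hs _)]
    have hind : iIndepFun (fun i ω => (s i).indicator (w i) (X i ω)) μ :=
      h.indep.comp (fun i z => (s i).indicator (w i) z.1)
        (fun i => ((hwm i).indicator (hs i)).comp measurable_fst)
    rw [← lintegral_prod_eq_prod_lintegral_of_indepFun Finset.univ _ hind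
      (fun i => ((hwm i).indicator (hs i)).comp (h.measurable_X i))]
    refine lintegral_congr fun ω => ?_
    by_cases hω : ω ∈ V ⁻¹' Set.univ.pi s
    · rw [Set.indicator_of_mem hω]
      refine Finset.prod_congr rfl fun i _ => ?_
      rw [Set.indicator_of_mem (hω i (Set.mem_univ i))]
    · rw [Set.indicator_of_notMem hω]
      simp only [Set.mem_preimage, Set.mem_pi, Set.mem_univ, forall_const, not_forall] at hω
      obtain ⟨i, hi⟩ := hω
      exact (Finset.prod_eq_zero (Finset.mem_univ i) (Set.indicator_of_notMem hi _)).symm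
  have e3 := congrArg (fun ν => ν G) (e1.symm.trans e2)
  simp only [Measure.map_apply hV hG, Measure.restrict_apply (hV hG),
    withDensity_apply _ (hV hG)] at e3
  exact e3

/-- A lower bound for the probability of an event, from a bound for its conditional
probability given the covariates. -/
theorem IsLogisticSample.le_measureReal (h : IsLogisticSample μ X Y β₀)
    {A : Set (Fin n → EuclideanSpace ℝ (Fin p))} (hA : MeasurableSet A)
    {G : (Fin n → ℝ) → Set (Fin n → EuclideanSpace ℝ (Fin p))} (hG : ∀ y, MeasurableSet (G y))
    {ε : ℝ} (hε : ε ≤ 1)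
    (hAG : ∀ x ∈ A, respProb (fun i => inner ℝ (x i) β₀) (fun y => ¬ x ∈ G (resp y)) ≤ ε) :
    μ.real {ω | (fun i => X i ω) ∈ A} * (1 - ε)
      ≤ μ.real {ω | (fun i => X i ω) ∈ A ∧ (fun i => X i ω) ∈ G (fun i => Y i ω)} := by
  classical
  have hV : Measurable fun ω i => X i ω := measurable_pi_lambda _ fun i => h.measurable_X i
  -- Splitting by the observed response vector gives disjoint measurable pieces; the target event
  -- only has to contain their union, so its own measurability plays no role.
  set S : (Fin n → Bool) → Set Ω := fun y =>
    {ω | (fun i => X i ω) ∈ A ∩ G (resp y) ∧ ∀ i, Y i ω = resp y i} with hS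
  have hSm : ∀ y, MeasurableSet (S y) := fun y => by
    have : S y = (fun ω i => X i ω) ⁻¹' (A ∩ G (resp y)) ∩ ⋂ i, Y i ⁻¹' {resp y i} := by
      ext; simp [hS]
    rw [this]
    exact (hV (hA.inter (hG _))).inter
      (MeasurableSet.iInter fun i => h.measurable_Y i (measurableSet_singleton _))
  have hdisj : Pairwise (Function.onFun Disjoint S) := fun y y' hyy' => by
    refine Set.disjoint_left.2 fun ω h1 h2 => hyy' (funext fun i => ?_)
    have := (h1.2 i).symm.trans (h2.2 i)
    simp only [resp] at this
    cases hy : y i <;> cases hy' : y' i <;> simp_all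
  have hsub : (⋃ y, S y) ⊆
      {ω | (fun i => X i ω) ∈ A ∧ (fun i => X i ω) ∈ G (fun i => Y i ω)} := by
    refine Set.iUnion_subset fun y ω hω => ⟨hω.1.1, ?_⟩
    have : (fun i => Y i ω) = resp y := funext hω.2
    rw [this]
    exact hω.1.2
  have key : ENNReal.ofReal (1 - ε) * μ {ω | (fun i => X i ω) ∈ A} ≤ μ (⋃ y, S y) := by
    rw [measure_iUnion hdisj hSm, tsum_fintype]
    have hwm : ∀ y : Fin n → Bool, Measurable fun ω => ∏ i, ENNReal.ofReal
        (if y i then sigmoid (inner ℝ (X i ω) β₀) else 1 - sigmoid (inner ℝ (X i ω) β₀)) :=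
      fun y => Finset.measurable_prod _ fun i _ => by
        have h1 := continuous_sigmoid.measurable.comp ((h.measurable_X i).inner_const (c := β₀))
        refine Measurable.ennreal_ofReal ?_
        split_ifs
        · exact h1
        · exact measurable_const.sub h1
    have hGm : ∀ y : Fin n → Bool, MeasurableSet {ω | (fun i => X i ω) ∈ G (resp y)} :=
      fun y => hV (hG _)
    have e : ∀ y, μ (S y) = ∫⁻ ω in {ω | (fun i => X i ω) ∈ A},
        {ω | (fun i => X i ω) ∈ G (resp y)}.indicator (fun ω => ∏ i, ENNReal.ofReal
        (if y i then sigmoid (inner ℝ (X i ω) β₀) else 1 - sigmoid (inner ℝ (X i ω) β₀))) ω ∂μ :=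
      fun y => by
        rw [h.measure_eq_lintegral y (hA.inter (hG _)), lintegral_indicator (hGm y),
          Measure.restrict_restrict (hGm y), Set.inter_comm]
        rfl
    simp only [e]
    rw [← lintegral_finsetSum _ fun y _ => (hwm y).indicator (hGm y), ← setLIntegral_const]
    refine setLIntegral_mono' (hV hA) fun ω hω => ?_
    have h1 := hAG _ hω
    have h2 := respProb_compl (fun i => inner ℝ (X i ω) β₀)
      (fun y => (fun i => X i ω) ∈ G (resp y))
    have h3 : 1 - ε ≤ respProb (fun i => inner ℝ (X i ω) β₀)
      (fun y => (fun i => X i ω) ∈ G (resp y)) := by linarith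
    refine (ENNReal.ofReal_le_ofReal h3).trans (le_of_eq ?_)
    rw [respProb, ENNReal.ofReal_sum_of_nonneg fun y _ => respWeight_nonneg _ y,
      Finset.sum_filter]
    refine Finset.sum_congr rfl fun y _ => ?_
    rw [Set.indicator_apply]
    simp only [Set.mem_ofPred_eq]
    split_ifs
    · refine ENNReal.ofReal_prod_of_nonneg fun i _ => ?_
      split_ifs
      · exact sigmoid_nonneg _
      · linarith [sigmoid_le_one (inner ℝ (X i ω) β₀)]
    · rfl
  have h4 := ENNReal.toReal_mono (measure_ne_top μ _) (key.trans (measure_mono hsub))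
  rw [ENNReal.toReal_mul, ENNReal.toReal_ofReal (by linarith)] at h4
  rw [mul_comm]
  exact h4

end Sampling

/-! ### Chernoff bounds for sums of bounded nonnegative variables -/

section Chernoff

open Real

variable {Ω : Type*} [MeasurableSpace Ω] {μ : Measure Ω} [IsProbabilityMeasure μ] {n : ℕ}

theorem exp_le_one_add_two_mul {z : ℝ} (h0 : 0 ≤ z) (h1 : z ≤ 1) : exp z ≤ 1 + 2 * z := by
  have h := convexOn_exp.2 (Set.mem_univ 0) (Set.mem_univ 1) (sub_nonneg.2 h1) h0 (by ring)
  simp only [smul_eq_mul, mul_zero, mul_one, zero_add, exp_zero] at h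
  nlinarith [exp_one_lt_d9]

theorem exp_neg_le_one_sub_half {z : ℝ} (h0 : 0 ≤ z) (h1 : z ≤ 1) : exp (-z) ≤ 1 - z / 2 := by
  have h := convexOn_exp.2 (Set.mem_univ 0) (Set.mem_univ (-1)) (sub_nonneg.2 h1) h0 (by ring)
  simp only [smul_eq_mul, mul_zero, mul_one, zero_add, exp_zero, mul_neg] at h
  have : exp (-1) ≤ 1 / 2 := by
    rw [exp_neg, inv_eq_one_div]
    exact one_div_le_one_div_of_le two_pos (by linarith [exp_one_gt_d9])
  nlinarith

theorem integrable_of_ae_mem_Icc {Z : Ω → ℝ} (hm : Measurable Z) {B : ℝ}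
    (hZ : ∀ᵐ ω ∂μ, Z ω ∈ Set.Icc 0 B) : Integrable Z μ :=
  Integrable.of_bound hm.aestronglyMeasurable B (hZ.mono fun ω h => by
    rw [norm_eq_abs, abs_of_nonneg h.1]; exact h.2)

theorem integrable_exp_of_ae_mem_Icc {Z : Ω → ℝ} (hm : Measurable Z) {B : ℝ}
    (hZ : ∀ᵐ ω ∂μ, Z ω ∈ Set.Icc 0 B) (t : ℝ) : Integrable (fun ω => exp (t * Z ω)) μ :=
  Integrable.of_bound (by fun_prop) (exp (|t| * B)) (hZ.mono fun ω h => by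
    rw [norm_eq_abs, abs_of_pos (exp_pos _)]
    refine exp_le_exp.2 ((le_abs_self _).trans ?_)
    rw [abs_mul, abs_of_nonneg h.1]
    exact mul_le_mul_of_nonneg_left h.2 (abs_nonneg t))

/-- Upper tail bound for a sum of independent bounded nonnegative variables. -/
theorem measureReal_sum_ge_le {Z : Fin n → Ω → ℝ} (hm : ∀ i, Measurable (Z i))
    (hind : iIndepFun Z μ) {B m : ℝ} (hB : 0 < B) (hZ : ∀ i, ∀ᵐ ω ∂μ, Z i ω ∈ Set.Icc 0 B)
    (hE : ∀ i, ∫ ω, Z i ω ∂μ ≤ m) :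
    μ.real {ω | 3 * (n * m) ≤ ∑ i, Z i ω} ≤ exp (-(n * m / B)) := by
  have hsum : ∀ᵐ ω ∂μ, (∑ i, Z i ω) ∈ Set.Icc 0 (∑ _i : Fin n, B) := by
    filter_upwards [ae_all_iff.2 hZ] with ω h
    exact ⟨Finset.sum_nonneg fun i _ => (h i).1, Finset.sum_le_sum fun i _ => (h i).2⟩
  -- With `t = 1 / B` the exponent lies in `[0, 1]`, where the chord bound gives an mgf of at most
  -- `exp (2 * m / B)`. The threshold contributes `-3` and the mgfs `+2`, in units of `n * m / B`.
  have h1 := measure_ge_le_exp_mul_mgf (μ := μ) (X := fun ω => ∑ i, Z i ω) (t := 1 / B)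
    (3 * (n * m)) (by positivity) (integrable_exp_of_ae_mem_Icc (by fun_prop) hsum _)
  have h2 : mgf (fun ω => ∑ i, Z i ω) μ (1 / B) = ∏ i, mgf (Z i) μ (1 / B) := by
    have := hind.mgf_sum hm Finset.univ (t := 1 / B)
    rw [← this]
    congr 1
    ext ω
    simp
  have h3 : ∀ i, mgf (Z i) μ (1 / B) ≤ exp (2 * m / B) := fun i => by
    have hi := integrable_of_ae_mem_Icc (hm i) (hZ i)
    calc mgf (Z i) μ (1 / B) ≤ ∫ ω, (1 + 2 * (1 / B * Z i ω)) ∂μ := by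
          refine integral_mono_ae (integrable_exp_of_ae_mem_Icc (hm i) (hZ i) _)
            ((integrable_const _).add ((hi.const_mul _).const_mul _)) ?_
          filter_upwards [hZ i] with ω h
          refine exp_le_one_add_two_mul (mul_nonneg (by positivity) h.1) ?_
          rw [one_div_mul_eq_div]
          exact (div_le_one hB).2 h.2
      _ = 1 + 2 * (1 / B * ∫ ω, Z i ω ∂μ) := by
          rw [integral_add (integrable_const _) ((hi.const_mul _).const_mul _), integral_const_mul,
            integral_const_mul]
          simp
      _ ≤ 1 + 2 * (1 / B * m) := by gcongr; exact hE i
      _ = 2 * m / B + 1 := by ring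
      _ ≤ exp (2 * m / B) := add_one_le_exp _
  refine h1.trans ?_
  rw [h2]
  calc exp (-(1 / B) * (3 * (n * m))) * ∏ i, mgf (Z i) μ (1 / B)
      ≤ exp (-(1 / B) * (3 * (n * m))) * ∏ _i : Fin n, exp (2 * m / B) := by
        gcongr with i _
        · exact fun i _ => mgf_nonneg
        · exact h3 i
    _ = exp (-(n * m / B)) := by
        rw [Finset.prod_const, Finset.card_univ, Fintype.card_fin, ← exp_nat_mul, ← exp_add]
        congr 1
        field_simp
        ring

/-- Lower tail bound for a sum of independent bounded nonnegative variables. -/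
theorem measureReal_sum_le_le {Z : Fin n → Ω → ℝ} (hm : ∀ i, Measurable (Z i))
    (hind : iIndepFun Z μ) {B m : ℝ} (hB : 0 < B) (hZ : ∀ i, ∀ᵐ ω ∂μ, Z i ω ∈ Set.Icc 0 B)
    (hE : ∀ i, m ≤ ∫ ω, Z i ω ∂μ) :
    μ.real {ω | ∑ i, Z i ω ≤ n * m / 4} ≤ exp (-(n * m / (4 * B))) := by
  have hsum : ∀ᵐ ω ∂μ, (∑ i, Z i ω) ∈ Set.Icc 0 (∑ _i : Fin n, B) := by
    filter_upwards [ae_all_iff.2 hZ] with ω h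
    exact ⟨Finset.sum_nonneg fun i _ => (h i).1, Finset.sum_le_sum fun i _ => (h i).2⟩
  have hB' : -(1 / B) ≤ 0 := by simpa using hB.le
  -- With `t = -1 / B` the threshold contributes `1/4` and the mgfs `-1/2`, in units of `n * m / B`.
  have h1 := measure_le_le_exp_mul_mgf (μ := μ) (X := fun ω => ∑ i, Z i ω) (t := -(1 / B))
    (n * m / 4) hB' (integrable_exp_of_ae_mem_Icc (by fun_prop) hsum _)
  have h2 : mgf (fun ω => ∑ i, Z i ω) μ (-(1 / B)) = ∏ i, mgf (Z i) μ (-(1 / B)) := by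
    have := hind.mgf_sum hm Finset.univ (t := -(1 / B))
    rw [← this]
    congr 1
    ext ω
    simp
  have h3 : ∀ i, mgf (Z i) μ (-(1 / B)) ≤ exp (-(m / (2 * B))) := fun i => by
    have hi := integrable_of_ae_mem_Icc (hm i) (hZ i)
    calc mgf (Z i) μ (-(1 / B)) ≤ ∫ ω, (1 - 1 / B * Z i ω / 2) ∂μ := by
          refine integral_mono_ae (integrable_exp_of_ae_mem_Icc (hm i) (hZ i) _)
            ((integrable_const _).sub ((hi.const_mul _).div_const _)) ?_
          filter_upwards [hZ i] with ω h
          rw [neg_mul]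
          refine exp_neg_le_one_sub_half (mul_nonneg (by positivity) h.1) ?_
          rw [one_div_mul_eq_div]
          exact (div_le_one hB).2 h.2
      _ = 1 - 1 / B * (∫ ω, Z i ω ∂μ) / 2 := by
          rw [integral_sub (integrable_const _) ((hi.const_mul _).div_const _), integral_div,
            integral_const_mul]
          simp
      _ ≤ 1 - 1 / B * m / 2 := by gcongr; exact hE i
      _ = -(m / (2 * B)) + 1 := by field_simp; ring
      _ ≤ exp (-(m / (2 * B))) := add_one_le_exp _
  refine h1.trans ?_
  rw [h2]
  calc exp (-(-(1 / B)) * (n * m / 4)) * ∏ i, mgf (Z i) μ (-(1 / B))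
      ≤ exp (-(-(1 / B)) * (n * m / 4)) * ∏ _i : Fin n, exp (-(m / (2 * B))) := by
        gcongr with i _
        · exact fun i _ => mgf_nonneg
        · exact h3 i
    _ = exp (-(n * m / (4 * B))) := by
        rw [Finset.prod_const, Finset.card_univ, Fintype.card_fin, ← exp_nat_mul, ← exp_add]
        congr 1
        field_simp
        ring

end Chernoff

/-! ### Population moments and the population information -/

section Population

open Real

variable {Ω : Type*} [MeasurableSpace Ω] {μ : Measure Ω} {p : ℕ}
  {X : Ω → EuclideanSpace ℝ (Fin p)} {m : ℕ} {a₁ a₂ a₃ : ℝ}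

theorem supp_smul_subset (t : ℝ) (u : EuclideanSpace ℝ (Fin p)) : supp (t • u) ⊆ supp u :=
  Submodule.smul_mem (suppSub (supp u)) t (Finset.Subset.refl _)

theorem CovariateConditions.ae_abs_inner_le (h : CovariateConditions μ X m a₁ a₂ a₃)
    (ha₃ : 0 ≤ a₃) : ∀ᵐ ω ∂μ, ∀ u : EuclideanSpace ℝ (Fin p), (supp u).card ≤ m →
      |inner ℝ (X ω) u| ≤ a₃ * √m * ‖u‖ := by
  filter_upwards [ae_all_iff.2 h.bounded] with ω hω u hu
  exact abs_inner_le_of_bdd hω hu ha₃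

theorem CovariateConditions.third_moment_le (h : CovariateConditions μ X m a₁ a₂ a₃)
    {u : EuclideanSpace ℝ (Fin p)} (hu : (supp u).card ≤ m) :
    ∫ ω, |inner ℝ (X ω) u| ^ 3 ∂μ ≤ a₂ * ‖u‖ ^ 3 := by
  rcases eq_or_ne u 0 with rfl | hu0
  · simp
  · have hn : 0 < ‖u‖ := norm_pos_iff.2 hu0
    have h1 := h.third_moment (‖u‖⁻¹ • u)
      ((Finset.card_le_card (supp_smul_subset _ _)).trans hu)
      (by rw [norm_smul, norm_inv, norm_norm, inv_mul_cancel₀ hn.ne'])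
    simp only [inner_smul_right, abs_mul, mul_pow, abs_inv, abs_norm] at h1
    rw [integral_const_mul, inv_pow, inv_mul_le_iff₀ (by positivity)] at h1
    linarith

theorem CovariateConditions.second_moment_ge (h : CovariateConditions μ X m a₁ a₂ a₃)
    {u : EuclideanSpace ℝ (Fin p)} (hu : (supp u).card ≤ m) :
    a₁ * ‖u‖ ^ 2 ≤ ∫ ω, inner ℝ (X ω) u ^ 2 ∂μ := by
  rcases eq_or_ne u 0 with rfl | hu0
  · simp
  · have hn : 0 < ‖u‖ := norm_pos_iff.2 hu0
    have h1 := h.second_moment (‖u‖⁻¹ • u)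
      ((Finset.card_le_card (supp_smul_subset _ _)).trans hu)
      (by rw [norm_smul, norm_inv, norm_norm, inv_mul_cancel₀ hn.ne'])
    simp only [inner_smul_right, mul_pow] at h1
    rw [integral_const_mul, inv_pow, le_inv_mul_iff₀ (by positivity)] at h1
    linarith

/-- Truncation at level `B`: if `|θ| ≤ B` the weight is at least `varFun B`; otherwise `z ^ 2 * |θ|
≤ |z| ^ 3 + |θ| ^ 3` makes the left side nonpositive. Thus third moments control the region where
the variance degenerates. -/
theorem varFun_mul_sq_ge {B : ℝ} (hB : 0 < B) (θ z : ℝ) :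
    varFun B * (z ^ 2 - (|z| ^ 3 + |θ| ^ 3) / B) ≤ varFun θ * z ^ 2 := by
  have hv := (varFun_pos B).le
  rcases le_total |θ| B with h | h
  · have h1 : 0 ≤ (|z| ^ 3 + |θ| ^ 3) / B := by positivity
    calc varFun B * (z ^ 2 - (|z| ^ 3 + |θ| ^ 3) / B) ≤ varFun B * z ^ 2 :=
          mul_le_mul_of_nonneg_left (by linarith) hv
      _ ≤ varFun θ * z ^ 2 := mul_le_mul_of_nonneg_right (varFun_mono_abs h) (sq_nonneg z)
  · have h1 : z ^ 2 ≤ (|z| ^ 3 + |θ| ^ 3) / B := by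
      rw [le_div_iff₀ hB, ← sq_abs z]
      have h2 : |z| ^ 2 * B ≤ |z| ^ 2 * |θ| := by gcongr
      have h3 : |z| ^ 2 * |θ| ≤ |z| ^ 3 + |θ| ^ 3 := by
        have hz := abs_nonneg z
        have ht := abs_nonneg θ
        rcases le_total |z| |θ| with h' | h'
        · have : |z| ^ 2 * |θ| ≤ |θ| ^ 2 * |θ| := by gcongr
          nlinarith [pow_nonneg hz 3]
        · have : |z| ^ 2 * |θ| ≤ |z| ^ 2 * |z| := by gcongr
          nlinarith [pow_nonneg ht 3]
      linarith
    calc varFun B * (z ^ 2 - (|z| ^ 3 + |θ| ^ 3) / B) ≤ varFun B * 0 :=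
          mul_le_mul_of_nonneg_left (by linarith) hv
      _ ≤ varFun θ * z ^ 2 := by
          rw [mul_zero]; exact mul_nonneg (varFun_pos θ).le (sq_nonneg z)

/-- The truncation level in the lower bound for the population information. -/
def truncLevel (a₀ a₁ a₂ : ℝ) : ℝ := 8 * (1 + a₀ ^ 3) * a₂ / a₁

/-- Lower bound for the population information matrix on sparse vectors. -/
theorem CovariateConditions.info_ge [IsProbabilityMeasure μ] (h : CovariateConditions μ X m a₁ a₂ a₃)
    (hX : Measurable X) {a₀ : ℝ} (ha₀ : 0 < a₀) (ha₁ : 0 < a₁) (ha₂ : 0 < a₂) (ha₃ : 0 < a₃)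
    {β₀ u : EuclideanSpace ℝ (Fin p)} (hβ₀ : ‖β₀‖ ≤ a₀) (hβs : (supp β₀).card ≤ m)
    (hu : (supp u).card ≤ m) (hu1 : ‖u‖ ≤ 1) (hu2 : 1 / 2 ≤ ‖u‖) :
    varFun (truncLevel a₀ a₁ a₂) * a₁ / 8 ≤
      ∫ ω, varFun (inner ℝ (X ω) β₀) * inner ℝ (X ω) u ^ 2 ∂μ := by
  set B := truncLevel a₀ a₁ a₂ with hBdef
  have hB : 0 < B := by rw [hBdef, truncLevel]; positivity
  have hbd := h.ae_abs_inner_le ha₃.le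
  have hmeas : ∀ v : EuclideanSpace ℝ (Fin p), Measurable fun ω => inner ℝ (X ω) v :=
    fun v => hX.inner_const
  have hcube : ∀ v : EuclideanSpace ℝ (Fin p), (supp v).card ≤ m →
      Integrable (fun ω => |inner ℝ (X ω) v| ^ 3) μ := fun v hv => by
    have := hmeas v
    refine Integrable.of_bound (by fun_prop) ((a₃ * √m * ‖v‖) ^ 3) (hbd.mono fun ω hω => ?_)
    rw [norm_eq_abs, abs_pow, abs_abs]
    have := hω v hv
    gcongr
  have hsq : Integrable (fun ω => inner ℝ (X ω) u ^ 2) μ := by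
    have := hmeas u
    refine Integrable.of_bound (by fun_prop) ((a₃ * √m * ‖u‖) ^ 2) (hbd.mono fun ω hω => ?_)
    rw [norm_eq_abs, abs_pow]
    have := hω u hu
    gcongr
  have hvsq : Integrable (fun ω => varFun (inner ℝ (X ω) β₀) * inner ℝ (X ω) u ^ 2) μ := by
    have h1 := hmeas u
    have h2 := continuous_varFun.measurable.comp (hmeas β₀)
    refine hsq.mono (h2.mul (h1.pow_const 2)).aestronglyMeasurable (ae_of_all _ fun ω => ?_)
    rw [norm_mul, norm_eq_abs (varFun _), abs_of_pos (varFun_pos _)]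
    exact mul_le_of_le_one_left (norm_nonneg _) (varFun_le_one _)
  have hmono := integral_mono
    ((hsq.sub (((hcube u hu).add (hcube β₀ hβs)).div_const B)).const_mul (varFun B)) hvsq
    (fun ω => varFun_mul_sq_ge hB (inner ℝ (X ω) β₀) (inner ℝ (X ω) u))
  refine le_trans ?_ hmono
  have e : ∫ ω, varFun B * (inner ℝ (X ω) u ^ 2
      - (|inner ℝ (X ω) u| ^ 3 + |inner ℝ (X ω) β₀| ^ 3) / B) ∂μ
      = varFun B * ((∫ ω, inner ℝ (X ω) u ^ 2 ∂μ) - ((∫ ω, |inner ℝ (X ω) u| ^ 3 ∂μ)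
        + ∫ ω, |inner ℝ (X ω) β₀| ^ 3 ∂μ) / B) := by
    have h1 := integral_const_mul (μ := μ) (varFun B) (fun ω => inner ℝ (X ω) u ^ 2
      - (|inner ℝ (X ω) u| ^ 3 + |inner ℝ (X ω) β₀| ^ 3) / B)
    have h2 := integral_sub hsq (((hcube u hu).add (hcube β₀ hβs)).div_const B)
    have h3 := integral_add (hcube u hu) (hcube β₀ hβs)
    simp only [Pi.add_apply] at h2
    rw [h1, h2, integral_div, h3]
  rw [show (∫ ω, varFun B * (((fun ω => inner ℝ (X ω) u ^ 2) - fun ω =>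
    ((fun ω => |inner ℝ (X ω) u| ^ 3) + fun ω => |inner ℝ (X ω) β₀| ^ 3) ω / B) ω) ∂μ) = _ from e]
  have h1 := h.second_moment_ge hu
  have h2 := h.third_moment_le hu
  have h3 := h.third_moment_le hβs
  have h4 : a₂ * ‖u‖ ^ 3 ≤ a₂ * 1 := by
    gcongr; exact pow_le_one₀ (norm_nonneg _) hu1
  have h5 : a₂ * ‖β₀‖ ^ 3 ≤ a₂ * a₀ ^ 3 := by gcongr
  have h6 : a₁ * (1 / 2) ^ 2 ≤ a₁ * ‖u‖ ^ 2 := by gcongr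
  -- The truncation level makes this correction at most `a₁ / 8`. Since `‖u‖ ≥ 1 / 2`, the second
  -- moment is at least `a₁ / 4`, so `a₁ / 8` survives.
  have h7 : ((∫ ω, |inner ℝ (X ω) u| ^ 3 ∂μ) + ∫ ω, |inner ℝ (X ω) β₀| ^ 3 ∂μ) / B
      ≤ a₁ / 8 := by
    rw [div_le_iff₀ hB]
    have : a₁ / 8 * B = (1 + a₀ ^ 3) * a₂ := by
      rw [hBdef, truncLevel]; field_simp
    rw [this]
    linarith
  rw [mul_div_assoc]
  exact mul_le_mul_of_nonneg_left (by linarith) (varFun_pos B).le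

end Population

/-! ### Uniform control of the design on sparse vectors -/

section GoodDesign

open Real

variable {n p : ℕ}

theorem sum_abs_inner_smul_pow (x : Fin n → EuclideanSpace ℝ (Fin p)) (t : ℝ)
    (u : EuclideanSpace ℝ (Fin p)) :
    ∑ i, |inner ℝ (x i) (t • u)| ^ 3 = |t| ^ 3 * ∑ i, |inner ℝ (x i) u| ^ 3 := by
  simp only [inner_smul_right, abs_mul, mul_pow, Finset.mul_sum]

theorem info_smul (x : Fin n → EuclideanSpace ℝ (Fin p)) (β₀ : EuclideanSpace ℝ (Fin p)) (t : ℝ)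
    (u : EuclideanSpace ℝ (Fin p)) : info x β₀ (t • u) = t ^ 2 * info x β₀ u := by
  simp only [info, inner_smul_right, Finset.mul_sum]
  exact Finset.sum_congr rfl fun i _ => by ring

theorem sum_abs_inner_add_pow_le (x : Fin n → EuclideanSpace ℝ (Fin p))
    (u v : EuclideanSpace ℝ (Fin p)) :
    ∑ i, |inner ℝ (x i) (u + v)| ^ 3
      ≤ 4 * (∑ i, |inner ℝ (x i) u| ^ 3) + 4 * ∑ i, |inner ℝ (x i) v| ^ 3 := by
  rw [Finset.mul_sum, Finset.mul_sum, ← Finset.sum_add_distrib]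
  refine Finset.sum_le_sum fun i _ => ?_
  rw [inner_add_right]
  have h1 : |inner ℝ (x i) u + inner ℝ (x i) v| ^ 3
      ≤ (|inner ℝ (x i) u| + |inner ℝ (x i) v|) ^ 3 := by gcongr; exact abs_add_le _ _
  have h2 := add_pow_le (abs_nonneg (inner ℝ (x i) u)) (abs_nonneg (inner ℝ (x i) v)) 3
  norm_num at h2
  linarith

theorem info_add_le (x : Fin n → EuclideanSpace ℝ (Fin p)) (β₀ u v : EuclideanSpace ℝ (Fin p)) :
    info x β₀ (u + v) ≤ 2 * info x β₀ u + 2 * info x β₀ v := by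
  rw [← norm_design_sq, ← norm_design_sq, ← norm_design_sq, map_add]
  nlinarith [norm_add_le (design x β₀ u) (design x β₀ v), norm_nonneg (design x β₀ u + design x β₀ v),
    sq_nonneg (‖design x β₀ u‖ - ‖design x β₀ v‖), norm_nonneg (design x β₀ u),
    norm_nonneg (design x β₀ v)]

/-- Pointwise, `z ^ 2 ≤ 1 + |z| ^ 3` and the variance weights are at most 1; this spares a separate
concentration bound for second moments. -/
theorem info_le_of_cube_le {x : Fin n → EuclideanSpace ℝ (Fin p)} (β₀ : EuclideanSpace ℝ (Fin p))
    {u : EuclideanSpace ℝ (Fin p)} {K : ℝ} (h : ∑ i, |inner ℝ (x i) u| ^ 3 ≤ K) :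
    info x β₀ u ≤ n + K := by
  have : info x β₀ u ≤ ∑ i, (1 + |inner ℝ (x i) u| ^ 3) := by
    refine Finset.sum_le_sum fun i _ => ?_
    have hz := abs_nonneg (inner ℝ (x i) u)
    rw [← sq_abs]
    refine (mul_le_of_le_one_left (by positivity) (varFun_le_one _)).trans ?_
    rcases le_total |inner ℝ (x i) u| 1 with h' | h'
    · have := pow_le_one₀ hz h' (n := 2)
      have := pow_nonneg hz 3
      linarith
    · have := pow_le_pow_right₀ h' (show 2 ≤ 3 by norm_num)
      linarith
  rw [Finset.sum_add_distrib] at this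
  simp only [Finset.sum_const, Finset.card_univ, Fintype.card_fin, nsmul_eq_mul, mul_one] at this
  linarith

/-- Self-bounding on the unit ball: a maximizer `w` with net point `v` satisfies `F w ≤ 4 * F v + 4
* (1 / 8) * F w`, hence `F w ≤ 8 * b`. Homogeneity does the rest. -/
theorem sum_abs_inner_pow_le_of_net {x : Fin n → EuclideanSpace ℝ (Fin p)} {J : Finset (Fin p)}
    {N : Finset (EuclideanSpace ℝ (Fin p))} {δ b : ℝ} (hδ : δ ≤ 1 / 2)
    (hN : ∀ v ∈ N, v ∈ suppSub J)
    (hnet : ∀ u ∈ suppSub J, ‖u‖ ≤ 1 → ∃ v ∈ N, ‖u - v‖ ≤ δ)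
    (hU : ∀ v ∈ N, ∑ i, |inner ℝ (x i) v| ^ 3 ≤ b) {u : EuclideanSpace ℝ (Fin p)}
    (hu : u ∈ suppSub J) : ∑ i, |inner ℝ (x i) u| ^ 3 ≤ 8 * b * ‖u‖ ^ 3 := by
  set F : EuclideanSpace ℝ (Fin p) → ℝ := fun u => ∑ i, |inner ℝ (x i) u| ^ 3 with hF
  have hcont : Continuous F := by rw [hF]; fun_prop
  have hcomp : IsCompact (Metric.closedBall 0 1 ∩ (suppSub J : Set (EuclideanSpace ℝ (Fin p)))) :=
    (isCompact_closedBall _ _).inter_right (isClosed_suppSub J)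
  obtain ⟨w, hw, hmax⟩ := hcomp.exists_isMaxOn ⟨0, by simp, Submodule.zero_mem _⟩
    hcont.continuousOn
  have hhom : ∀ v ∈ suppSub J, F v ≤ ‖v‖ ^ 3 * F w := fun v hv => by
    rcases eq_or_ne v 0 with rfl | hv0
    · simp [hF]
    · have hn : 0 < ‖v‖ := norm_pos_iff.2 hv0
      have h1 : F (‖v‖⁻¹ • v) ≤ F w := hmax
        ⟨by simp [norm_smul, hn.ne'], Submodule.smul_mem _ _ hv⟩
      have h2 : F (‖v‖⁻¹ • v) = |‖v‖⁻¹| ^ 3 * F v := sum_abs_inner_smul_pow x _ v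
      rw [h2, abs_inv, abs_norm, inv_pow, inv_mul_le_iff₀ (by positivity)] at h1
      exact h1
  have hFw : 0 ≤ F w := Finset.sum_nonneg fun _ _ => by positivity
  have hwb : F w ≤ 8 * b := by
    obtain ⟨v, hv, hwv⟩ := hnet w hw.2 (by simpa using hw.1)
    have h1 := sum_abs_inner_add_pow_le x v (w - v)
    rw [add_sub_cancel] at h1
    have h2 := hhom (w - v) (Submodule.sub_mem _ hw.2 (hN v hv))
    have h3 : ‖w - v‖ ^ 3 * F w ≤ (1 / 2) ^ 3 * F w := by
      gcongr; exact hwv.trans hδ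
    have h4 := hU v hv
    change F w ≤ 4 * F v + 4 * F (w - v) at h1
    change F v ≤ b at h4
    linarith
  calc F u ≤ ‖u‖ ^ 3 * F w := hhom u hu
    _ ≤ ‖u‖ ^ 3 * (8 * b) := by gcongr
    _ = _ := by ring

/-- It suffices to control the design on a net. -/
theorem goodDesign_of_net {x : Fin n → EuclideanSpace ℝ (Fin p)} {β₀ : EuclideanSpace ℝ (Fin p)}
    {m : ℕ} {a b c δ : ℝ} (hδ : δ ≤ 1 / 2) (hb : 0 ≤ b)
    (hδc : δ ^ 2 * (1 + 24 * b) ≤ c / 16)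
    (N : Finset (Fin p) → Finset (EuclideanSpace ℝ (Fin p)))
    (hN : ∀ J, ∀ v ∈ N J, v ∈ suppSub J)
    (hnet : ∀ J, ∀ u ∈ suppSub J, ‖u‖ ≤ 1 → ∃ v ∈ N J, ‖u - v‖ ≤ δ)
    (hU : ∀ J : Finset (Fin p), J.card ≤ m → ∀ v ∈ N J,
      ∑ i, |inner ℝ (x i) v| ^ 3 ≤ 3 * (n * b))
    (hL : ∀ J : Finset (Fin p), J.card ≤ m → ∀ v ∈ N J, 1 / 2 ≤ ‖v‖ →
      n * c / 4 ≤ info x β₀ v)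
    (hbdd : ∀ i j, |x i j| ≤ a) : GoodDesign x β₀ m (c / 16) (24 * b) a := by
  have hcube : ∀ J : Finset (Fin p), J.card ≤ m → ∀ u ∈ suppSub J,
      ∑ i, |inner ℝ (x i) u| ^ 3 ≤ 24 * b * n * ‖u‖ ^ 3 := fun J hJ u hu =>
    (sum_abs_inner_pow_le_of_net hδ (hN J) (hnet J) (hU J hJ) hu).trans (le_of_eq (by ring))
  have hn0 : (0 : ℝ) ≤ n := Nat.cast_nonneg n
  have hinfo : ∀ J : Finset (Fin p), J.card ≤ m → ∀ u ∈ suppSub J,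
      info x β₀ u ≤ n * (1 + 24 * b) * ‖u‖ ^ 2 := fun J hJ u hu => by
    rcases eq_or_ne u 0 with rfl | hu0
    · simp [info]
    · have hn : 0 < ‖u‖ := norm_pos_iff.2 hu0
      have h1 := hcube J hJ (‖u‖⁻¹ • u) (Submodule.smul_mem _ _ hu)
      rw [norm_smul, norm_inv, norm_norm, inv_mul_cancel₀ hn.ne'] at h1
      have h2 := info_le_of_cube_le β₀ h1
      rw [info_smul, inv_pow, inv_mul_le_iff₀ (by positivity)] at h2
      linarith
  refine ⟨fun u hu => ?_, fun u hu => hcube _ hu u (Finset.Subset.refl _), hbdd⟩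
  rcases eq_or_ne u 0 with rfl | hu0
  · simp [info]
  have hn : 0 < ‖u‖ := norm_pos_iff.2 hu0
  have huS : u ∈ suppSub (supp u) := Finset.Subset.refl _
  set w := ‖u‖⁻¹ • u with hw
  have hw1 : ‖w‖ = 1 := by rw [hw, norm_smul, norm_inv, norm_norm, inv_mul_cancel₀ hn.ne']
  have hwS : w ∈ suppSub (supp u) := Submodule.smul_mem _ _ huS
  obtain ⟨v, hv, hwv⟩ := hnet _ w hwS hw1.le
  have hv2 : 1 / 2 ≤ ‖v‖ := by
    have := norm_sub_norm_le w v
    linarith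
  have h1 := hL _ hu v hv hv2
  -- This gives `info w ≥ info v / 2 - info (v - w)`, at least `n c / 8 - n c / 16` by the choice of
  -- the mesh `δ`.
  have h2 := info_add_le x β₀ w (v - w)
  rw [add_sub_cancel] at h2
  have h3 := hinfo _ hu (v - w) (Submodule.sub_mem _ (hN _ v hv) hwS)
  rw [norm_sub_rev] at h3
  have h4 : n * (1 + 24 * b) * ‖w - v‖ ^ 2 ≤ n * (1 + 24 * b) * δ ^ 2 := by gcongr
  have h5 : (n : ℝ) * (δ ^ 2 * (1 + 24 * b)) ≤ n * (c / 16) := by gcongr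
  have h6 : n * c / 16 ≤ info x β₀ w := by linarith
  rw [hw, info_smul, inv_pow, le_inv_mul_iff₀ (by positivity)] at h6
  linarith

variable {Ω : Type*} [MeasurableSpace Ω] {μ : Measure Ω} [IsProbabilityMeasure μ]
  {X : Fin n → Ω → EuclideanSpace ℝ (Fin p)} {β₀ : EuclideanSpace ℝ (Fin p)}

/-- Union bound over at most `3 * p ^ m` supports and `(1 + 2 / δ) ^ m` net points each. At a net
point the summands are bounded by `(a₃ * √m) ^ 3` and `(a₃ * √m) ^ 2`, which yields the two
exponentials. -/
theorem le_measureReal_goodDesign (hX : ∀ i, Measurable (X i)) (hind : iIndepFun X μ)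
    (hp : 0 < p) {m : ℕ} (hm : 1 ≤ m) {a₀ a₁ a₂ a₃ c δ : ℝ} (ha₀ : 0 < a₀) (ha₁ : 0 < a₁)
    (ha₂ : 0 < a₂) (ha₃ : 0 < a₃) (hβ₀ : ‖β₀‖ ≤ a₀) (hβs : (supp β₀).card ≤ m)
    (hcov : ∀ i, CovariateConditions μ (X i) m a₁ a₂ a₃)
    (hc : c = varFun (truncLevel a₀ a₁ a₂) * a₁ / 8) (hδ0 : 0 < δ) (hδ : δ ≤ 1 / 2)
    (hδc : δ ^ 2 * (1 + 24 * a₂) ≤ c / 16) :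
    1 - 3 * (p : ℝ) ^ m * (1 + 2 / δ) ^ m * (exp (-(n * a₂ / (a₃ * √m) ^ 3))
        + exp (-(n * c / (4 * (a₃ * √m) ^ 2))))
      ≤ μ.real {ω | GoodDesign (fun i => X i ω) β₀ m (c / 16) (24 * a₂) a₃} := by
  classical
  have hm' : (0 : ℝ) < m := by exact_mod_cast hm
  have hsm : 0 < √(m : ℝ) := sqrt_pos.2 hm'
  choose N hN hNcard hnet using fun J : Finset (Fin p) => exists_net_submodule (suppSub J) hδ0
  set S : Finset (Finset (Fin p)) := Finset.univ.filter fun J => J.card ≤ m with hS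
  set U : EuclideanSpace ℝ (Fin p) → Set Ω := fun v =>
    {ω | 3 * (n * a₂) ≤ ∑ i, |inner ℝ (X i ω) v| ^ 3} with hU
  set L : EuclideanSpace ℝ (Fin p) → Set Ω := fun v =>
    {ω | 1 / 2 ≤ ‖v‖ ∧ info (fun i => X i ω) β₀ v ≤ n * c / 4} with hL
  set bad : Set Ω := ⋃ J ∈ S, ⋃ v ∈ N J, (U v ∪ L v) with hbad
  have hae : ∀ᵐ ω ∂μ, ∀ i, ∀ u : EuclideanSpace ℝ (Fin p), (supp u).card ≤ m →
      |inner ℝ (X i ω) u| ≤ a₃ * √m * ‖u‖ :=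
    ae_all_iff.2 fun i => (hcov i).ae_abs_inner_le ha₃.le
  have hbdd : ∀ᵐ ω ∂μ, ∀ i j, |X i ω j| ≤ a₃ :=
    ae_all_iff.2 fun i => ae_all_iff.2 (hcov i).bounded
  have hcover : ∀ᵐ ω ∂μ, ω ∈ (Set.univ : Set Ω) → ω ∈
      {ω | GoodDesign (fun i => X i ω) β₀ m (c / 16) (24 * a₂) a₃} ∪ bad := by
    filter_upwards [hbdd] with ω hω _
    by_cases hb : ω ∈ bad
    · exact Or.inr hb
    · refine Or.inl (goodDesign_of_net hδ ha₂.le hδc N (fun J v hv => (hN J v hv).1) hnet ?_ ?_ hω)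
      · intro J hJ v hv
        by_contra! h
        exact hb (Set.mem_biUnion (by simpa [hS] using hJ) (Set.mem_biUnion hv (Or.inl h.le)))
      · intro J hJ v hv hv2
        by_contra! h
        exact hb (Set.mem_biUnion (by simpa [hS] using hJ)
          (Set.mem_biUnion hv (Or.inr ⟨hv2, h.le⟩)))
  have hUb : ∀ J ∈ S, ∀ v ∈ N J, μ.real (U v) ≤ exp (-(n * a₂ / (a₃ * √m) ^ 3)) := by
    intro J hJ v hv
    have hvm : (supp v).card ≤ m :=
      (Finset.card_le_card (hN J v hv).1).trans (by simpa [hS] using hJ)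
    have hmeas : ∀ i, Measurable fun ω => inner ℝ (X i ω) v := fun i => (hX i).inner_const
    refine measureReal_sum_ge_le (Z := fun i ω => |inner ℝ (X i ω) v| ^ 3)
      (fun i => ((hmeas i).abs.pow_const 3)) ?_ (by positivity) (fun i => ?_) (fun i => ?_)
    · exact hind.comp (fun _ z => |inner ℝ z v| ^ 3) (fun i => by fun_prop)
    · filter_upwards [hae] with ω hω
      refine ⟨by positivity, ?_⟩
      have h1 := hω i v hvm
      have h2 : a₃ * √m * ‖v‖ ≤ a₃ * √m := mul_le_of_le_one_right (by positivity) (hN J v hv).2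
      have := h1.trans h2
      gcongr
    · refine ((hcov i).third_moment_le hvm).trans (mul_le_of_le_one_right ha₂.le ?_)
      exact pow_le_one₀ (norm_nonneg _) (hN J v hv).2
  have hLb : ∀ J ∈ S, ∀ v ∈ N J, μ.real (L v) ≤ exp (-(n * c / (4 * (a₃ * √m) ^ 2))) := by
    intro J hJ v hv
    have hvm : (supp v).card ≤ m :=
      (Finset.card_le_card (hN J v hv).1).trans (by simpa [hS] using hJ)
    by_cases hv2 : 1 / 2 ≤ ‖v‖
    · have hvf := continuous_varFun.measurable
      have hg : Measurable fun z : EuclideanSpace ℝ (Fin p) =>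
          varFun (inner ℝ z β₀) * inner ℝ z v ^ 2 := by fun_prop
      have e : L v = {ω | ∑ i, varFun (inner ℝ (X i ω) β₀) * inner ℝ (X i ω) v ^ 2
          ≤ n * c / 4} := by
        ext ω; simp only [hL, Set.mem_ofPred_eq, hv2, true_and, info]
      rw [e]
      refine measureReal_sum_le_le (Z := fun i ω =>
        varFun (inner ℝ (X i ω) β₀) * inner ℝ (X i ω) v ^ 2)
        (fun i => hg.comp (hX i)) ?_ (by positivity) (fun i => ?_) (fun i => ?_)
      · exact hind.comp (fun _ z => varFun (inner ℝ z β₀) * inner ℝ z v ^ 2) (fun i => hg)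
      · filter_upwards [hae] with ω hω
        refine ⟨mul_nonneg (varFun_pos _).le (sq_nonneg _), ?_⟩
        have h1 := hω i v hvm
        have h2 : a₃ * √m * ‖v‖ ≤ a₃ * √m := mul_le_of_le_one_right (by positivity) (hN J v hv).2
        refine (mul_le_of_le_one_left (sq_nonneg _) (varFun_le_one _)).trans ?_
        rw [← sq_abs]
        have := h1.trans h2
        gcongr
      · rw [hc]
        exact (hcov i).info_ge (hX i) ha₀ ha₁ ha₂ ha₃ hβ₀ hβs hvm (hN J v hv).2 hv2
    · have e : L v = ∅ := by
        ext ω; exact ⟨fun h => absurd h.1 hv2, fun h => h.elim⟩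
      rw [e]
      simp [(exp_pos _).le]
  have hbadb : μ.real bad ≤ 3 * (p : ℝ) ^ m * (1 + 2 / δ) ^ m *
      (exp (-(n * a₂ / (a₃ * √m) ^ 3)) + exp (-(n * c / (4 * (a₃ * √m) ^ 2)))) := by
    set E := exp (-(n * a₂ / (a₃ * √m) ^ 3)) + exp (-(n * c / (4 * (a₃ * √m) ^ 2))) with hE
    have hE0 : 0 ≤ E := by positivity
    have hD1 : 1 ≤ 1 + 2 / δ := by
      have : 0 ≤ 2 / δ := by positivity
      linarith
    calc μ.real bad ≤ ∑ J ∈ S, μ.real (⋃ v ∈ N J, (U v ∪ L v)) :=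
          measureReal_biUnion_finset_le _ _
      _ ≤ ∑ _J ∈ S, (1 + 2 / δ) ^ m * E := by
          refine Finset.sum_le_sum fun J hJ => ?_
          calc _ ≤ ∑ v ∈ N J, μ.real (U v ∪ L v) := measureReal_biUnion_finset_le _ _
            _ ≤ ∑ _v ∈ N J, E := Finset.sum_le_sum fun v hv =>
                (measureReal_union_le _ _).trans (add_le_add (hUb J hJ v hv) (hLb J hJ v hv))
            _ = (N J).card * E := by simp
            _ ≤ _ := by
                refine mul_le_mul_of_nonneg_right ((hNcard J).trans ?_) hE0
                refine pow_le_pow_right₀ hD1 ((finrank_suppSub_le J).trans ?_)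
                simpa [hS] using hJ
      _ = S.card * ((1 + 2 / δ) ^ m * E) := by simp
      _ ≤ (3 * (p : ℝ) ^ m) * ((1 + 2 / δ) ^ m * E) := by
          gcongr
          exact card_finset_card_le hp m
      _ = _ := by ring
  have h1 : μ.real (Set.univ : Set Ω) ≤ μ.real
      ({ω | GoodDesign (fun i => X i ω) β₀ m (c / 16) (24 * a₂) a₃} ∪ bad) :=
    ENNReal.toReal_mono (measure_ne_top _ _) (measure_mono_ae hcover)
  rw [probReal_univ] at h1
  have h2 := measureReal_union_le (μ := μ)
    {ω | GoodDesign (fun i => X i ω) β₀ m (c / 16) (24 * a₂) a₃} bad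
  linarith

end GoodDesign

/-! ### Balancing the constants -/

section Constants

open Real

/-- Since `√(2q) ^ 3 ≤ 4 * q ^ 2`, both exponents are at least `κ * n / q ^ 2`. The prefactor is at
most `p ^ (5 * q)`, which the assumption on `n` lets half of the exponent absorb. -/
theorem design_failure_le {n p q : ℕ} (hq : 1 ≤ q) {a₂ a₃ c D κ : ℝ}
    (ha₂ : 0 < a₂) (ha₃ : 0 < a₃) (hc : 0 < c) (hD : 0 < D) (hp6 : (6 : ℝ) ≤ p) (hpD : D ≤ p)
    (hκ : 0 < κ) (hκ1 : κ ≤ a₂ / (4 * a₃ ^ 3)) (hκ2 : κ ≤ c / (8 * a₃ ^ 2))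
    (hn : 10 / κ * ((q : ℝ) ^ 3 * log p) ≤ n) :
    3 * (p : ℝ) ^ (2 * q) * D ^ (2 * q) * (exp (-(n * a₂ / (a₃ * √(2 * q : ℕ)) ^ 3))
        + exp (-(n * c / (4 * (a₃ * √(2 * q : ℕ)) ^ 2))))
      ≤ exp (-(κ / 2 * ((n : ℝ) / (q : ℝ) ^ 3))) := by
  have hq' : (1 : ℝ) ≤ q := by exact_mod_cast hq
  have hq0 : (0 : ℝ) < q := by linarith
  have hn0 : (0 : ℝ) ≤ n := Nat.cast_nonneg n
  have hp0 : (0 : ℝ) < p := by linarith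
  have hsq : √((2 * q : ℕ) : ℝ) ^ 2 = 2 * q := by
    rw [sq_sqrt (Nat.cast_nonneg _)]; push_cast; ring
  have hs1 : 1 ≤ √((2 * q : ℕ) : ℝ) := by
    rw [one_le_sqrt]; push_cast; linarith
  have hs3 : √((2 * q : ℕ) : ℝ) ^ 3 ≤ 4 * (q : ℝ) ^ 2 := by
    calc √((2 * q : ℕ) : ℝ) ^ 3 ≤ √((2 * q : ℕ) : ℝ) ^ 4 := pow_le_pow_right₀ hs1 (by norm_num)
      _ = (√((2 * q : ℕ) : ℝ) ^ 2) ^ 2 := by ring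
      _ = _ := by rw [hsq]; ring
  have e1 : κ * (n / (q : ℝ) ^ 2) ≤ n * a₂ / (a₃ * √(2 * q : ℕ)) ^ 3 := by
    calc κ * (n / (q : ℝ) ^ 2) ≤ a₂ / (4 * a₃ ^ 3) * (n / (q : ℝ) ^ 2) := by gcongr
      _ = n * a₂ / (a₃ ^ 3 * (4 * (q : ℝ) ^ 2)) := by field_simp
      _ ≤ _ := by rw [mul_pow]; gcongr
  have e2 : κ * (n / (q : ℝ) ^ 2) ≤ n * c / (4 * (a₃ * √(2 * q : ℕ)) ^ 2) := by
    rw [mul_pow, hsq]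
    calc κ * (n / (q : ℝ) ^ 2) ≤ c / (8 * a₃ ^ 2) * (n / (q : ℝ)) := by
          gcongr
          rw [sq]
          exact le_mul_of_one_le_left hq0.le hq'
      _ = _ := by field_simp; ring
  have e3 : (6 : ℝ) ≤ (p : ℝ) ^ q := hp6.trans (le_self_pow₀ (by linarith) (by omega))
  have e4 : (p : ℝ) ^ (5 * q) = exp (5 * q * log p) := by
    rw [← exp_log hp0, ← exp_nat_mul, log_exp]
    push_cast; ring_nf
  have e5 : 5 * q * log p ≤ κ / 2 * (n / (q : ℝ) ^ 2) := by
    rw [← mul_div_assoc, le_div_iff₀ (by positivity)]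
    rw [div_mul_eq_mul_div, div_le_iff₀ hκ] at hn
    nlinarith
  have e6 : κ / 2 * (n / (q : ℝ) ^ 3) ≤ κ / 2 * (n / (q : ℝ) ^ 2) := by
    gcongr
    norm_num
  calc _ ≤ 3 * (p : ℝ) ^ (2 * q) * (p : ℝ) ^ (2 * q) * (exp (-(κ * (n / (q : ℝ) ^ 2)))
        + exp (-(κ * (n / (q : ℝ) ^ 2)))) := by gcongr
    _ = 6 * (p : ℝ) ^ (4 * q) * exp (-(κ * (n / (q : ℝ) ^ 2))) := by ring
    _ ≤ (p : ℝ) ^ q * (p : ℝ) ^ (4 * q) * exp (-(κ * (n / (q : ℝ) ^ 2))) := by gcongr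
    _ = (p : ℝ) ^ (5 * q) * exp (-(κ * (n / (q : ℝ) ^ 2))) := by ring
    _ = exp (5 * q * log p - κ * (n / (q : ℝ) ^ 2)) := by rw [e4, ← exp_add]; ring_nf
    _ ≤ _ := exp_le_exp.2 (by linarith)

/-- After the exponential the remaining power of `p` is at most `-ν - ε * (1 + ν) / 4`; the surplus
absorbs `3 * C` for large `p`. -/
theorem response_failure_le {p : ℕ} {C δ ε ν κ : ℝ} (hC : 0 < C) (hε : 0 < ε) (hν : 0 < ν)
    (hp : (1 : ℝ) ≤ p) (hpC : (3 * C) ^ (4 / (ε * (1 + ν))) ≤ p)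
    (hδ : (1 + ε / 4) * (1 + ν) ≤ (1 - δ) ^ 3 * κ) :
    3 * (p * (C * exp (-((1 - δ) ^ 3 * (2 * κ * log p) / 2)))) ≤ 1 / (p : ℝ) ^ ν := by
  have hp0 : (0 : ℝ) < p := by linarith
  have hlog : 0 ≤ log p := log_nonneg hp
  have hpow : 0 < (p : ℝ) ^ ν := rpow_pos_of_pos hp0 _
  have hτ : 0 < ε * (1 + ν) / 4 := by positivity
  have h1 : 3 * C ≤ (p : ℝ) ^ (ε * (1 + ν) / 4) := by
    calc 3 * C = ((3 * C) ^ (4 / (ε * (1 + ν)))) ^ (ε * (1 + ν) / 4) := by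
          rw [← rpow_mul (by positivity)]
          have : 4 / (ε * (1 + ν)) * (ε * (1 + ν) / 4) = 1 := by field_simp
          rw [this, rpow_one]
      _ ≤ _ := rpow_le_rpow (by positivity) hpC hτ.le
  have h2 : exp (-((1 - δ) ^ 3 * (2 * κ * log p) / 2)) ≤ exp (-((1 + ε / 4) * (1 + ν) * log p)) :=
    exp_le_exp.2 (by nlinarith)
  have h3 : (p : ℝ) * exp (-((1 + ε / 4) * (1 + ν) * log p)) * (p : ℝ) ^ (ε * (1 + ν) / 4)
      = 1 / (p : ℝ) ^ ν := by
    rw [rpow_def_of_pos hp0, rpow_def_of_pos hp0, one_div, ← exp_neg]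
    nth_rewrite 1 [← exp_log hp0]
    rw [← exp_add, ← exp_add]
    congr 1
    ring
  calc 3 * (p * (C * exp (-((1 - δ) ^ 3 * (2 * κ * log p) / 2))))
      = p * exp (-((1 - δ) ^ 3 * (2 * κ * log p) / 2)) * (3 * C) := by ring
    _ ≤ p * exp (-((1 + ε / 4) * (1 + ν) * log p)) * (p : ℝ) ^ (ε * (1 + ν) / 4) := by gcongr
    _ = _ := h3

/-- The selection result for explicit constants. -/
theorem le_measureReal_ebicSelects {a₀ a₁ a₂ a₃ ε ν : ℝ} (ha₀ : 0 < a₀) (ha₁ : 0 < a₁)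
    (ha₂ : 0 < a₂) (ha₃ : 0 < a₃) (hε : 0 < ε) (hν : 0 < ν)
    {c₀ c M κ κ₂ δ δ₂ r₀ A ρ b C₁ C₂ : ℝ}
    (hc₀ : c₀ = varFun (truncLevel a₀ a₁ a₂) * a₁ / 8) (hc₀pos : 0 < c₀)
    (hδ₂0 : 0 < δ₂) (hδ₂ : δ₂ ≤ 1 / 2) (hδ₂c : δ₂ ^ 2 * (1 + 24 * a₂) ≤ c₀ / 16)
    (hc : c = c₀ / 16) (hM : M = 24 * a₂) (hcpos : 0 < c) (hMpos : 0 < M)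
    (hκ : κ = (1 + ε / 2) * (1 + ν)) (hκpos : 0 < κ) (hδ0 : 0 < δ) (hδ1 : δ ≤ 1)
    (hδκ : (1 + ε / 4) * (1 + ν) ≤ (1 - δ) ^ 3 * κ) (hr₀ : r₀ = c / (16 * M)) (hr₀pos : 0 < r₀)
    (hA : A = 64 * κ / c) (hApos : 0 < A) (hρ : ρ = min 1 (r₀ / a₀)) (hρpos : 0 < ρ)
    (hκ₂ : κ₂ = min (a₂ / (4 * a₃ ^ 3)) (c₀ / (8 * a₃ ^ 2))) (hκ₂pos : 0 < κ₂)
    (hb : b = log (1 + δ)) (hbpos : 0 < b)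
    (hC₁1 : 10 / κ₂ ≤ C₁) (hC₁2 : 4 * κ * a₃ ^ 2 / (c * b ^ 2) ≤ C₁) (hC₁3 : A / r₀ ^ 2 ≤ C₁)
    (hC₁4 : 16 * M ^ 2 * A ^ 3 / (ε * (1 + ν)) ^ 2 ≤ C₁)
    (hC₂1 : A ≤ C₂) (hC₂2 : 8 / (c * ρ) ≤ C₂)
    {γ : ℝ} {n p q : ℕ} (hn : 2 ≤ n) (hq : 1 ≤ q)
    {Ω : Type*} [MeasurableSpace Ω] {μ : Measure Ω} [IsProbabilityMeasure μ]
    {X : Fin n → Ω → EuclideanSpace ℝ (Fin p)} {Y : Fin n → Ω → ℝ}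
    {β₀ : EuclideanSpace ℝ (Fin p)} (hsample : IsLogisticSample μ X Y β₀)
    (hβ₀ : ‖β₀‖ ≤ a₀) (hβs : (supp β₀).card ≤ q)
    (hcov : ∀ i, CovariateConditions μ (X i) (2 * q) a₁ a₂ a₃)
    (hp6 : (6 : ℝ) ≤ p) (hpD : 1 + 2 / δ₂ ≤ (p : ℝ))
    (hpC' : (3 * (1 + 2 / δ)) ^ (4 / (ε * (1 + ν))) ≤ (p : ℝ))
    (hnC : C₁ * ((q : ℝ) ^ 3 * log p) ≤ n)
    (hnβ : ∀ j ∈ supp β₀, C₂ * ((q : ℝ) * log (n * (p : ℝ) ^ (2 * γ)) / |β₀ j| ^ 2) ≤ (n : ℝ))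
    (hsqrt : (p : ℝ) ^ ((1 + ε) * (1 + ν) - γ) < √n) :
    (1 - exp (-(κ₂ / 2 * ((n : ℝ) / (q : ℝ) ^ 3)))) * (1 - 1 / (p : ℝ) ^ ν) ≤
      μ.real {ω | EBICSelects γ q (fun i => X i ω) (fun i => Y i ω) (supp β₀)} := by
  have hp0 : (0 : ℝ) < p := by linarith
  have hq' : (1 : ℝ) ≤ q := by exact_mod_cast hq
  have hq0 : (0 : ℝ) < q := by linarith
  have hn0 : (0 : ℝ) < n := by exact_mod_cast (by omega : 0 < n)
  obtain ⟨ℓ, hℓ⟩ : ∃ ℓ, ℓ = log p := ⟨_, rfl⟩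
  have hℓpos : 0 < ℓ := by rw [hℓ]; exact log_pos (by linarith)
  have hnC' : ∀ C, C ≤ C₁ → C * ((q : ℝ) ^ 3 * ℓ) ≤ n := fun C hC => by
    refine le_trans ?_ hnC
    rw [hℓ] at hℓpos ⊢
    gcongr
  have hn1 := hnC' _ hC₁1
  have hn2 := hnC' _ hC₁2
  have hn3 := hnC' _ hC₁3
  have hn4 := hnC' _ hC₁4
  obtain ⟨lam, hlam⟩ : ∃ lam, lam = log n + 2 * γ * log p := ⟨_, rfl⟩
  have hlamlog : log (n * (p : ℝ) ^ (2 * γ)) = lam := by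
    rw [log_mul hn0.ne' (rpow_pos_of_pos hp0 _).ne', log_rpow hp0, hlam]
  -- Logarithms of the assumption on `√n`: each variable is penalized by more than `2 (1 + ε) (1 +
  -- ν) log p`.
  have hlam2 : 2 * ((1 + ε) * (1 + ν)) * ℓ < lam := by
    have h := log_lt_log (rpow_pos_of_pos hp0 _) hsqrt
    rw [log_rpow hp0, log_sqrt hn0.le] at h
    rw [hlam, hℓ]
    linarith
  have hℓlam : ℓ ≤ lam := by
    have h1 : 1 ≤ (1 + ε) * (1 + ν) :=
      one_le_mul_of_one_le_of_one_le (by linarith) (by linarith)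
    have : ℓ ≤ 2 * ((1 + ε) * (1 + ν)) * ℓ := le_mul_of_one_le_left hℓpos.le (by linarith)
    linarith
  have hlampos : 0 < lam := hℓpos.trans_le hℓlam
  -- The factor `1 + ε / 2` in `κ` splits the slack: one half pays for the union bound over models,
  -- the other for the cubic errors.
  obtain ⟨s, hs⟩ : ∃ s, s = 2 * κ * ℓ := ⟨_, rfl⟩
  have hspos : 0 < s := by rw [hs]; positivity
  obtain ⟨r₁, hr₁⟩ : ∃ r₁, r₁ = √(32 * q * s / (c * n)) := ⟨_, rfl⟩
  have hr₁0 : 0 ≤ r₁ := by rw [hr₁]; exact sqrt_nonneg _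
  have hr₁sq : r₁ ^ 2 = 32 * q * s / (c * n) := by rw [hr₁, sq_sqrt (by positivity)]
  have hr₁A : r₁ ^ 2 = A * (q * ℓ) / n := by rw [hr₁sq, hs, hA]; field_simp; ring
  have hqq : (q : ℝ) * ℓ ≤ (q : ℝ) ^ 3 * ℓ := by
    gcongr; exact le_self_pow₀ hq' (by norm_num)
  have hq2 : (q : ℝ) ^ 2 * ℓ ≤ (q : ℝ) ^ 3 * ℓ := by
    gcongr
    norm_num
  have hr₁r₀ : r₁ ≤ r₀ := by
    refine le_of_sq_le_sq ?_ hr₀pos.le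
    rw [hr₁A, div_le_iff₀ hn0]
    rw [div_mul_eq_mul_div, div_le_iff₀ (by positivity)] at hn3
    have : A * (q * ℓ) ≤ A * ((q : ℝ) ^ 3 * ℓ) := by gcongr
    linarith
  -- Squared, the left side is a constant times `q ^ 3 * ℓ ^ 3 / n`; this is where `n` must dominate
  -- `q ^ 3 * log p`.
  have hcubic : 4 * M * n * r₁ ^ 3 ≤ ε * (1 + ν) * ℓ := by
    refine le_of_sq_le_sq ?_ (by positivity)
    have e : (4 * M * n * r₁ ^ 3) ^ 2 = 16 * M ^ 2 * A ^ 3 * ((q : ℝ) ^ 3 * ℓ) * ℓ ^ 2 / n := by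
      calc (4 * M * n * r₁ ^ 3) ^ 2 = 16 * M ^ 2 * n ^ 2 * (r₁ ^ 2) ^ 3 := by ring
        _ = _ := by rw [hr₁A]; field_simp
    rw [e, div_le_iff₀ hn0]
    rw [div_mul_eq_mul_div, div_le_iff₀ (by positivity)] at hn4
    calc 16 * M ^ 2 * A ^ 3 * ((q : ℝ) ^ 3 * ℓ) * ℓ ^ 2
        ≤ n * (ε * (1 + ν)) ^ 2 * ℓ ^ 2 := by gcongr
      _ = _ := by ring
  have hsuper : s + 4 * M * n * r₁ ^ 3 < log n + 2 * γ * log p := by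
    rw [← hlam, hs, hκ]
    have : 2 * ((1 + ε / 2) * (1 + ν)) * ℓ + ε * (1 + ν) * ℓ
        = 2 * ((1 + ε) * (1 + ν)) * ℓ := by ring
    linarith
  have hβpos : ∀ j ∈ supp β₀, 0 < |β₀ j| := fun j hj => abs_pos.2 (mem_supp.1 hj)
  have hnβ' : ∀ j ∈ supp β₀, ∀ C, C ≤ C₂ →
      C * (q * lam) ≤ n * |β₀ j| ^ 2 := fun j hj C hC => by
    have h := hnβ j hj
    rw [hlamlog, ← mul_div_assoc, div_le_iff₀ (pow_pos (hβpos j hj) 2)] at h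
    refine le_trans ?_ h
    gcongr
  have hβmin : ∀ j ∈ supp β₀, r₁ ≤ |β₀ j| := fun j hj => by
    refine le_of_sq_le_sq ?_ (abs_nonneg _)
    rw [hr₁A, div_le_iff₀ hn0]
    have h1 := hnβ' j hj A hC₂1
    have h2 : A * (q * ℓ) ≤ A * (q * lam) := by gcongr
    linarith
  have hsub : ∀ j ∈ supp β₀, q * (log n + 2 * γ * log p)
      < c / 4 * n * (|β₀ j| * min |β₀ j| r₀) := fun j hj => by
    rw [← hlam]
    have hb0 := hβpos j hj
    have hba : |β₀ j| ≤ a₀ := by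
      have := PiLp.norm_apply_le β₀ j
      rw [norm_eq_abs] at this
      exact this.trans hβ₀
    -- As `|β₀ j| ≤ a₀`, the linear regime of the loss is still at least `ρ` times the quadratic
    -- one.
    have h1 : |β₀ j| * ρ ≤ min |β₀ j| r₀ := by
      refine le_min (mul_le_of_le_one_right hb0.le (hρ ▸ min_le_left _ _)) ?_
      calc |β₀ j| * ρ ≤ a₀ * (r₀ / a₀) := by
            gcongr
            rw [hρ]; exact min_le_right _ _
        _ = r₀ := by field_simp
    have h2 := hnβ' j hj _ hC₂2
    rw [div_mul_eq_mul_div, div_le_iff₀ (by positivity)] at h2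
    have h3 : c / 4 * n * (|β₀ j| * (|β₀ j| * ρ)) ≤ c / 4 * n * (|β₀ j| * min |β₀ j| r₀) := by
      gcongr
    have h4 : 0 < q * lam := by positivity
    have h5 : c / 4 * n * (|β₀ j| * (|β₀ j| * ρ)) = n * |β₀ j| ^ 2 * (c * ρ) / 4 := by ring
    linarith
  have hη : exp (√(q * s) * (a₃ * √(2 * q : ℕ) / √(c * n))) ≤ 1 + δ := by
    rw [← exp_log (by linarith : 0 < 1 + δ), ← hb]
    refine exp_le_exp.2 (le_of_sq_le_sq ?_ hbpos.le)
    rw [mul_pow, div_pow, mul_pow, sq_sqrt (by positivity), sq_sqrt (by positivity),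
      sq_sqrt (by positivity), ← mul_div_assoc, div_le_iff₀ (by positivity)]
    rw [div_mul_eq_mul_div, div_le_iff₀ (by positivity)] at hn2
    push_cast
    calc q * s * (a₃ ^ 2 * (2 * q)) = 4 * κ * a₃ ^ 2 * ((q : ℝ) ^ 2 * ℓ) := by rw [hs]; ring
      _ ≤ 4 * κ * a₃ ^ 2 * ((q : ℝ) ^ 3 * ℓ) := by gcongr
      _ ≤ _ := by linarith
  have hfail := response_failure_le (p := p) (C := 1 + 2 / δ) (δ := δ) (κ := κ)
    (by positivity) hε hν (by linarith) hpC' hδκ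
  rw [← hℓ, ← hs] at hfail
  have hpν : 1 / (p : ℝ) ^ ν ≤ 1 := by
    rw [div_le_one (rpow_pos_of_pos hp0 _)]
    exact one_le_rpow (by linarith) hν.le
  have hcond := hsample.le_measureReal
    (measurableSet_goodDesign β₀ (2 * q) c M a₃)
    (G := fun y => {x | GoodResponse x y β₀ (supp β₀) q s})
    (fun y => measurableSet_goodResponse y β₀ (supp β₀) q s) hpν
    (fun x hx => (respProb_not_goodResponse_le hx (by omega) (Nat.cast_pos.1 hp0) hq hcpos ha₃.le (supp β₀)
      hβs hδ0 hδ1 hspos.le hη (by linarith)).trans hfail)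
  have hdesign := le_measureReal_goodDesign (m := 2 * q) hsample.measurable_X
    (hsample.indep.comp (fun _ z => z.1) (fun _ => measurable_fst)) (Nat.cast_pos.1 hp0) (by omega)
    ha₀ ha₁ ha₂ ha₃ hβ₀ (hβs.trans (by omega)) hcov hc₀ hδ₂0 hδ₂ hδ₂c
  have hdfail := design_failure_le (n := n) (p := p) hq ha₂ ha₃ hc₀pos
    (by positivity : 0 < 1 + 2 / δ₂) hp6 hpD hκ₂pos (hκ₂ ▸ min_le_left _ _)
    (hκ₂ ▸ min_le_right _ _) (by rw [← hℓ]; exact hn1)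
  rw [← hc, ← hM] at hdesign
  calc (1 - exp (-(κ₂ / 2 * ((n : ℝ) / (q : ℝ) ^ 3)))) * (1 - 1 / (p : ℝ) ^ ν)
      ≤ μ.real {ω | GoodDesign (fun i => X i ω) β₀ (2 * q) c M a₃} * (1 - 1 / (p : ℝ) ^ ν) :=
        mul_le_mul_of_nonneg_right (by linarith) (by linarith)
    _ ≤ _ := hcond
    _ ≤ _ := measureReal_mono fun ω hω => ebicSelects_of_good hω.1 (by omega) hq hβs hω.2 hMpos
        hcpos hspos hr₀ hr₁sq hr₁0 hr₁r₀ hsuper hβmin hsub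

end Constants

end LogisticEBIC

end

/-! ### The theorem: choice of the constants -/

open LogisticEBIC in
theorem mainTheorem3 (a₀ a₁ a₂ a₃ ε ν : ℝ) (ha₀ : 0 < a₀) (ha₁ : 0 < a₁) (ha₂ : 0 < a₂)
    (ha₃ : 0 < a₃) (hε : 0 < ε) (hν : 0 < ν) :
    ∃ C₀ C₁ C₂ C₃ : ℝ, 0 < C₀ ∧ 0 < C₁ ∧ 0 < C₂ ∧ 0 < C₃ ∧
      ∀ (γ : ℝ) (n p q : ℕ), 0 ≤ γ → 2 ≤ n → 2 ≤ p → 1 ≤ q →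
      ∀ (Ω : Type*) [MeasurableSpace Ω] (μ : Measure Ω) [IsProbabilityMeasure μ]
        (X : Fin n → Ω → EuclideanSpace ℝ (Fin p)) (Y : Fin n → Ω → ℝ)
        (β₀ : EuclideanSpace ℝ (Fin p)),
        LogisticEBIC.IsLogisticSample μ X Y β₀ →
        ‖β₀‖ ≤ a₀ →
        (LogisticEBIC.supp β₀).card ≤ q →
        (∀ i, LogisticEBIC.CovariateConditions μ (X i) (2 * q) a₁ a₂ a₃) →
        C₀ ≤ (p : ℝ) →
        C₁ * ((q : ℝ) ^ 3 * Real.log p) ≤ (n : ℝ) →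
        (∀ j ∈ LogisticEBIC.supp β₀,
          C₂ * ((q : ℝ) * Real.log (n * (p : ℝ) ^ (2 * γ)) / |β₀ j| ^ 2) ≤ (n : ℝ)) →
        (p : ℝ) ^ ((1 + ε) * (1 + ν) - γ) < Real.sqrt n →
        (1 - Real.exp (-(C₃ * ((n : ℝ) / (q : ℝ) ^ 3)))) * (1 - 1 / (p : ℝ) ^ ν) ≤
          μ.real {ω | LogisticEBIC.EBICSelects γ q (fun i => X i ω) (fun i => Y i ω)
            (LogisticEBIC.supp β₀)} := by
  obtain ⟨c₀, hc₀⟩ : ∃ c₀, c₀ = varFun (truncLevel a₀ a₁ a₂) * a₁ / 8 := ⟨_, rfl⟩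
  have hc₀pos : 0 < c₀ := by
    rw [hc₀]; have := varFun_pos (truncLevel a₀ a₁ a₂); positivity
  obtain ⟨δ₂, hδ₂0, hδ₂, hδ₂c⟩ : ∃ δ₂ : ℝ, 0 < δ₂ ∧ δ₂ ≤ 1 / 2 ∧
      δ₂ ^ 2 * (1 + 24 * a₂) ≤ c₀ / 16 := by
    have hpos : 0 < c₀ / 16 / (1 + 24 * a₂) := by positivity
    refine ⟨min (1 / 2) (√(c₀ / 16 / (1 + 24 * a₂))), by positivity, min_le_left _ _, ?_⟩
    rw [← le_div_iff₀ (by positivity)]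
    calc _ ≤ (√(c₀ / 16 / (1 + 24 * a₂))) ^ 2 := by gcongr; exact min_le_right _ _
      _ = _ := Real.sq_sqrt hpos.le
  obtain ⟨c, hc⟩ : ∃ c, c = c₀ / 16 := ⟨_, rfl⟩
  obtain ⟨M, hM⟩ : ∃ M, M = 24 * a₂ := ⟨_, rfl⟩
  have hcpos : 0 < c := by rw [hc]; positivity
  have hMpos : 0 < M := by rw [hM]; positivity
  obtain ⟨κ, hκ⟩ : ∃ κ, κ = (1 + ε / 2) * (1 + ν) := ⟨_, rfl⟩
  have hκpos : 0 < κ := by rw [hκ]; positivity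
  obtain ⟨δ, hδ0, hδ1, hδκ⟩ : ∃ δ : ℝ, 0 < δ ∧ δ ≤ 1 ∧
      (1 + ε / 4) * (1 + ν) ≤ (1 - δ) ^ 3 * κ := by
    have h1 : ε / (12 + 6 * ε) ≤ 1 := by rw [div_le_one (by positivity)]; linarith
    have h0 : 0 < ε / (12 + 6 * ε) := by positivity
    -- This `δ` solves `(1 - 3δ)(1 + ε/2) = 1 + ε/4`, and `(1 - δ)^3 ≥ 1 - 3δ`.
    refine ⟨ε / (12 + 6 * ε), h0, h1, ?_⟩
    have h2 : 1 - 3 * (ε / (12 + 6 * ε)) ≤ (1 - ε / (12 + 6 * ε)) ^ 3 := by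
      have := mul_nonneg (sq_nonneg (ε / (12 + 6 * ε)))
        (by linarith : 0 ≤ 3 - ε / (12 + 6 * ε))
      nlinarith
    have h3 : (1 - 3 * (ε / (12 + 6 * ε))) * (1 + ε / 2) = 1 + ε / 4 := by
      field_simp; ring
    rw [hκ, ← h3, mul_assoc]
    gcongr
  obtain ⟨r₀, hr₀⟩ : ∃ r₀, r₀ = c / (16 * M) := ⟨_, rfl⟩
  have hr₀pos : 0 < r₀ := by rw [hr₀]; positivity
  obtain ⟨A, hA⟩ : ∃ A, A = 64 * κ / c := ⟨_, rfl⟩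
  have hApos : 0 < A := by rw [hA]; positivity
  obtain ⟨ρ, hρ⟩ : ∃ ρ, ρ = min 1 (r₀ / a₀) := ⟨_, rfl⟩
  have hρpos : 0 < ρ := by rw [hρ]; positivity
  obtain ⟨κ₂, hκ₂⟩ : ∃ κ₂, κ₂ = min (a₂ / (4 * a₃ ^ 3)) (c₀ / (8 * a₃ ^ 2)) := ⟨_, rfl⟩
  have hκ₂pos : 0 < κ₂ := by rw [hκ₂]; positivity
  obtain ⟨b, hb⟩ : ∃ b, b = Real.log (1 + δ) := ⟨_, rfl⟩
  have hbpos : 0 < b := by rw [hb]; exact Real.log_pos (by linarith)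
  -- The four parts of the constant for `q ^ 3 * log p` serve the design failure, the Chernoff
  -- correction `1 + δ`, `r₁ ≤ r₀` and the cubic error. The two for the signal strength give `r₁ ≤
  -- |β₀ j|` and the loss of models missing `j`.
  refine ⟨max (max 6 (1 + 2 / δ₂)) ((3 * (1 + 2 / δ)) ^ (4 / (ε * (1 + ν)))),
    max (max (10 / κ₂) (4 * κ * a₃ ^ 2 / (c * b ^ 2)))
      (max (A / r₀ ^ 2) (16 * M ^ 2 * A ^ 3 / (ε * (1 + ν)) ^ 2)),
    max A (8 / (c * ρ)), κ₂ / 2, by positivity, by positivity, by positivity, by positivity, ?_⟩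
  intro γ n p q _ hn _ hq Ω _ μ _ X Y β₀ hsample hβ₀ hβs hcov hpC hnC hnβ hsqrt
  exact le_measureReal_ebicSelects ha₀ ha₁ ha₂ ha₃ hε hν hc₀ hc₀pos hδ₂0 hδ₂ hδ₂c hc hM hcpos
    hMpos hκ hκpos hδ0 hδ1 hδκ hr₀ hr₀pos hA hApos hρ hρpos hκ₂ hκ₂pos hb hbpos
    ((le_max_left _ _).trans (le_max_left _ _)) ((le_max_right _ _).trans (le_max_left _ _))
    ((le_max_left _ _).trans (le_max_right _ _)) ((le_max_right _ _).trans (le_max_right _ _))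
    (le_max_left _ _) (le_max_right _ _) hn hq hsample hβ₀ hβs hcov
    (((le_max_left _ _).trans (le_max_left _ _)).trans hpC)
    (((le_max_right _ _).trans (le_max_left _ _)).trans hpC)
    ((le_max_right _ _).trans hpC) hnC hnβ hsqrt
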